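/- Let $L\ge 1$, $m_1,m_2>0$, $\Omega>0$, $\overline\gamma_1,\overline\gamma_2>0$ and $\alpha_1,\alpha_2>1$, where $2\alpha_1\in\mathbb N$ and $\alpha_2=\alpha_1+\tfrac12$. For $i\in\{1,\dots,L\}$ and $j\in\{1,2\}$ let $N_{i,j}$ and $I_{i,j}$ be mutually independent real random variables such that $N_{i,j}^2$ has density $$\frac{m_j^{m_j}x^{m_j-1}}{\Omega^{m_j}\Gamma(m_j)}e^{-m_jx/\Omega}\quad(x>0)$$ (Nakagami-$m_j$ fading of mean square $\Omega$) and $I_{i,j}$ has the inverse-gamma density $$\frac{\overline\gamma_j^{\alpha_j}}{\Gamma(\alpha_j)y^{\alpha_j+1}}e^{-\overline\gamma_j/y}\quad(y>0).$$ Put $N_i=(N_{i,1}N_{i,2})^2$ and $I_i=I_{i,1}I_{i,2}$. Select an index $i^*$ with $I_{i^*}=\max_{1\le i\le L}I_i$ (a measurable random index), and let $$\gamma_{\rm out}=N_{i^*}\max_{1\le i\le L}I_i .$$ Write $\overline\gamma=\Omega^2\,\overline\gamma_1\overline\gamma_2$, $\tilde\gamma=m_1m_2/\overline\gamma$, $\mathcal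 S_1=\dfrac1{\Gamma(m_1)\Gamma(m_2)\Gamma(\alpha_1)\Gamma(\alpha_2)}$ and, for integers $i_1,i_2\ge0$ and $n=(n_0,\dots,n_{2\alpha_1-1})\in\mathbb N_0^{2\alpha_1}$ with $\sum_j n_j=i_2$, $$q=\alpha_1+\alpha_2+\sum_{j=1}^{2\alpha_1-1}j\,n_j,\qquad \mathcal A=(-1)^{i_1+i_2}\frac{i_2!}{n_0!\,n_1!\cdots n_{2\alpha_1-1}!}\prod_{j=1}^{2\alpha_1-1}\Big(\frac{2^j}{j!}\Big)^{n_j}.$$ Let $G^{m,n}_{p,q}$ be the Meijer G-function, $$G^{m,n}_{p,q}\Big(z\,\Big|{a_1,\dots,a_p\atop b_1,\dots,b_q}\Big)=\frac1{2\pi i}\int_{\mathcal L}\frac{\prod_{j=1}^m\Gamma(b_j-s)\prod_{k=1}^n\Gamma(1-a_k+s)}{\prod_{j=m+1}^q\Gamma(1-b_j+s)\prod_{k=n+1}^p\Gamma(a_k-s)}\,z^s\,ds,$$ where $\mathcal L$ is a vertical line, directed upwards, with the poles of the $\Gamma(b_j-s)$, $j\le m$, on its right and those of the $\Gamma(1-a_k+s)$,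 $k\le n$, on its left. Then $\gamma_{\rm out}$ is absolutely continuous and positive almost surely; a PDF of it vanishes on $(-\infty,0]$ and is given for $\gamma>0$ by $$f_{\gamma_{\rm out}}(\gamma)=\sum_{i_1=0}^{L-1}\sum_{i_2=0}^{i_1}\binom{L-1}{i_1}\binom{i_1}{i_2}\sum_{n_0+\cdots+n_{2\alpha_1-1}=i_2}\frac{\gamma^{-1}\mathcal A\,L\,\mathcal S_1}{(i_2+1)^{q-1/2}}\;G^{2,2}_{2,2}\bigg(\frac{\tilde\gamma\,\gamma}{(i_2+1)^2}\,\bigg|{\frac{3/2-q}2,\ \frac{5/2-q}2\atop m_1,\ m_2}\bigg).$$ Its CDF is $0$ for $\gamma\le0$ and, for $\gamma>0$, $$F_{\gamma_{\rm out}}(\gamma)=\sum_{i_1=0}^{L-1}\sum_{i_2=0}^{i_1}\binom{L-1}{i_1}\binom{i_1}{i_2}\sum_{n_0+\cdots+n_{2\alpha_1-1}=i_2}\frac{\mathcal A\,L\,\mathcal S_1}{(i_2+1)^{q-1/2}}\;G^{2,3}_{3,3}\bigg(\frac{\tilde\gamma\,\gamma}{(i_2+1)^2}\,\bigg|{1,\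 \frac{3/2-q}2,\ \frac{5/2-q}2\atop m_1,\ m_2,\ 0}\bigg).$$ -/

import Mathlib

open MeasureTheory ProbabilityTheory

noncomputable section

/-- The integrand of the Mellin–Barnes integral of the Meijer G-function
`G^{m,n}_{p,q}(z | a₁,…,a_p ; b₁,…,b_q)`:
`∏_{j ≤ m} Γ(b_j - s) ∏_{k ≤ n} Γ(1 - a_k + s) z^s /
  (∏_{j > m} Γ(1 - b_j + s) ∏_{k > n} Γ(a_k - s))`.
Indices start at `0` here; `Complex.Gamma` vanishes at the poles of the gamma function, so that
`(Complex.Gamma ·)⁻¹` is the entire function `1 / Γ`. -/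
def meijerIntegrand (m n : ℕ) {p q : ℕ} (a : Fin p → ℂ) (b : Fin q → ℂ) (z s : ℂ) : ℂ :=
  (∏ j : Fin q,
      if (j : ℕ) < m then Complex.Gamma (b j - s) else (Complex.Gamma (1 - b j + s))⁻¹) *
    (∏ k : Fin p,
      if (k : ℕ) < n then Complex.Gamma (1 - a k + s) else (Complex.Gamma (a k - s))⁻¹) *
    z ^ s

/-- The vertical line `Re s = c` separates the poles of the `Γ(b_j - s)`, `j ≤ m` (to its right)
from those of the `Γ(1 - a_k + s)`, `k ≤ n` (to its left). -/
def MeijerSeparates (m n : ℕ) {p q : ℕ} (a : Fin p → ℂ) (b : Fin q → ℂ) (c : ℝ) : Prop :=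
  (∀ j : Fin q, (j : ℕ) < m → c < (b j).re) ∧
    (∀ k : Fin p, (k : ℕ) < n → (a k).re - 1 < c)

open Classical in
/-- The Meijer G-function `G^{m,n}_{p,q}(z | a ; b) = (1 / 2πi) ∫ (meijerIntegrand) ds` along a
vertical line from `c - i∞` to `c + i∞` that separates the two families of poles (the value does
not depend on the line). If no separating vertical line exists the value is `0` by convention. -/
def meijerG (m n : ℕ) {p q : ℕ} (a : Fin p → ℂ) (b : Fin q → ℂ) (z : ℂ) : ℂ :=
  if h : ∃ c : ℝ, MeijerSeparates m n a b c then
    (1 / (2 * (Real.pi : ℂ))) *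
      ∫ t : ℝ, meijerIntegrand m n a b z ((h.choose : ℂ) + (t : ℂ) * Complex.I)
  else 0

/-- Density of the inverse-gamma distribution with shape `α` and scale `g`. -/
def invGammaPDFReal (α g y : ℝ) : ℝ :=
  if 0 < y then g ^ α / (Real.Gamma α * y ^ (α + 1)) * Real.exp (-(g / y)) else 0

/-- The inverse-gamma distribution with shape `α` and scale `g`. -/
def invGammaMeasure (α g : ℝ) : Measure ℝ :=
  volume.withDensity fun y => ENNReal.ofReal (invGammaPDFReal α g y)

/-- The double-shadowing channel for `L` UAVs and two scattering regions. `N i j` and `I i j` are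
the multipath and shadowing coefficients of UAV `i` in region `j`. The square of `N i j` is the
square of a Nakagami-`m j` variable of mean square `msq`, that is, gamma distributed with shape
`m j` and rate `m j / msq`; `I i j` is inverse-gamma with shape `α j` and scale `g j`; all the
coefficients are independent. -/
structure IsDoubleShadowingChannel {Ω : Type*} [MeasurableSpace Ω] (μ : Measure Ω) {L : ℕ}
    (m α g : Fin 2 → ℝ) (msq : ℝ) (N I : Fin L → Fin 2 → Ω → ℝ) : Prop where
  measurable_multipath : ∀ i j, Measurable (N i j)
  measurable_shadowing : ∀ i j, Measurable (I i j)
  law_multipath : ∀ i j, HasLaw (fun ω => N i j ω ^ 2) (gammaMeasure (m j) (m j / msq)) μ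
  law_shadowing : ∀ i j, HasLaw (I i j) (invGammaMeasure (α j) (g j)) μ
  indep : iIndepFun
    (fun k : (Fin L × Fin 2) ⊕ (Fin L × Fin 2) =>
      Sum.elim (fun p : Fin L × Fin 2 => N p.1 p.2) (fun p : Fin L × Fin 2 => I p.1 p.2) k) μ

/-- `N_i = (N_{i,1} N_{i,2})²`. -/
def multipathGain {Ω : Type*} {L : ℕ} (N : Fin L → Fin 2 → Ω → ℝ) (i : Fin L) (ω : Ω) : ℝ :=
  (N i 0 ω * N i 1 ω) ^ 2

/-- `I_i = I_{i,1} I_{i,2}`. -/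
def shadowingGain {Ω : Type*} {L : ℕ} (I : Fin L → Fin 2 → Ω → ℝ) (i : Fin L) (ω : Ω) : ℝ :=
  I i 0 ω * I i 1 ω

/-- `sel ω` is the index of the selected UAV: one whose shadowing variable is the largest. -/
def IsShadowingSelection {Ω : Type*} [MeasurableSpace Ω] {L : ℕ} (I : Fin L → Fin 2 → Ω → ℝ)
    (sel : Ω → Fin L) : Prop :=
  Measurable sel ∧ ∀ ω i, shadowingGain I i ω ≤ shadowingGain I (sel ω) ω

/-- The output SNR `γ_out = N_i · max_{1 ≤ i ≤ L} I_i`, where the factor `N_i` is that of the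
selected UAV. -/
def outputSNR {Ω : Type*} {L : ℕ} (N I : Fin L → Fin 2 → Ω → ℝ) (sel : Ω → Fin L) (ω : Ω) : ℝ :=
  multipathGain N (sel ω) ω * ⨆ i, shadowingGain I i ω

/-- `S₁ = 1 / (Γ(m₁) Γ(m₂) Γ(α₁) Γ(α₂))`. -/
def snrConst (m α : Fin 2 → ℝ) : ℝ :=
  1 / (Real.Gamma (m 0) * Real.Gamma (m 1) * Real.Gamma (α 0) * Real.Gamma (α 1))

/-- `γ̃ = m₁ m₂ / γ̄`, with `γ̄ = msq² g₁ g₂`. -/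
def snrScale (m g : Fin 2 → ℝ) (msq : ℝ) : ℝ :=
  m 0 * m 1 / (msq ^ 2 * (g 0 * g 1))

/-- `q = α₁ + α₂ + ∑_j j n_j`. -/
def snrExponent (α : Fin 2 → ℝ) {K : ℕ} (n : Fin K → ℕ) : ℝ :=
  α 0 + α 1 + ∑ j : Fin K, ((j : ℕ) : ℝ) * (n j : ℝ)

/-- `A = (-1)^{i₁+i₂} · i₂! / (n_0! ⋯ n_{K-1}!) · ∏_j (2^j / j!)^{n_j}`
(the factor `j = 0` of the last product is `1`). -/
def snrCoeff {K : ℕ} (i₁ i₂ : ℕ) (n : Fin K → ℕ) : ℝ :=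
  (i₂.factorial : ℝ) / (∏ j : Fin K, ((n j).factorial : ℝ)) *
    (∏ j : Fin K, ((2 : ℝ) ^ (j : ℕ) / ((j : ℕ).factorial : ℝ)) ^ n j) * (-1) ^ (i₁ + i₂)

/-- `A L S₁ / (i₂ + 1)^{q - 1/2}`. -/
def snrWeight (L : ℕ) (m α : Fin 2 → ℝ) {K : ℕ} (i₁ i₂ : ℕ) (n : Fin K → ℕ) : ℝ :=
  snrCoeff i₁ i₂ n * (L : ℝ) * snrConst m α / ((i₂ : ℝ) + 1) ^ (snrExponent α n - 1 / 2)

/-- The closed form of the output SNR's PDF: the sum over `0 ≤ i₁ ≤ L - 1`, `0 ≤ i₂ ≤ i₁` and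
`n_0 + ⋯ + n_{K-1} = i₂`, with `K = 2 α₁`. -/
def outputPDFFormula (L K : ℕ) (m α g : Fin 2 → ℝ) (msq x : ℝ) : ℂ :=
  ∑ i₁ ∈ Finset.range L, ∑ i₂ ∈ Finset.range (i₁ + 1),
    ((L - 1).choose i₁ : ℂ) * (i₁.choose i₂ : ℂ) *
      ∑ n ∈ Finset.piAntidiag (Finset.univ : Finset (Fin K)) i₂,
        (x : ℂ)⁻¹ * (snrWeight L m α i₁ i₂ n : ℂ) *
          meijerG 2 2
            ![(((3 / 2 - snrExponent α n) / 2 : ℝ) : ℂ), (((5 / 2 - snrExponent α n) / 2 : ℝ) : ℂ)]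
            ![(m 0 : ℂ), (m 1 : ℂ)]
            ((snrScale m g msq * x / ((i₂ : ℝ) + 1) ^ 2 : ℝ) : ℂ)

/-- The closed form of the output SNR's CDF. -/
def outputCDFFormula (L K : ℕ) (m α g : Fin 2 → ℝ) (msq x : ℝ) : ℂ :=
  ∑ i₁ ∈ Finset.range L, ∑ i₂ ∈ Finset.range (i₁ + 1),
    ((L - 1).choose i₁ : ℂ) * (i₁.choose i₂ : ℂ) *
      ∑ n ∈ Finset.piAntidiag (Finset.univ : Finset (Fin K)) i₂,
        (snrWeight L m α i₁ i₂ n : ℂ) *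
          meijerG 2 3
            ![1, (((3 / 2 - snrExponent α n) / 2 : ℝ) : ℂ),
              (((5 / 2 - snrExponent α n) / 2 : ℝ) : ℂ)]
            ![(m 0 : ℂ), (m 1 : ℂ), 0]
            ((snrScale m g msq * x / ((i₂ : ℝ) + 1) ^ 2 : ℝ) : ℂ)

end

/-!
In logarithmic coordinates products of independent positive variables become convolutions, so the
argument runs on densities with respect to `dx / x` and their Mellin transforms. Three facts
combine.

* If `X` and `Y` are independent gamma variables of shapes `a` and `a + 1/2`, then `2 √(X Y)` is a
  gamma variable of shape `2 a`, by Legendre's duplication formula. Applied to the reciprocals of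
  the shadowing variables, it makes the relation `α₂ = α₁ + 1/2` turn the largest of the `I_i` into
  the smallest of `L` independent Erlang variables of shape `K = 2 α₁`.
* The tail of an Erlang variable is `e^{-u}` times a polynomial. Expanding its `(L - 1)`-st power
  writes the law of the smallest Erlang variable as a signed combination of gamma laws, and this
  expansion is the sum over `i₁`, `i₂` and `n`.
* For a single gamma law the density is an inverse Mellin transform of a product of gamma functions,
  that is, a Meijer `G`-function. Averaging over one more independent factor multiplies the Mellin
  transform by a moment of that factor, and the duplication formula splits the factor `Γ(k + 2 s)`
  coming from the Erlang variable into the two gamma functions of the upper parameters. Averaging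
  over the density `1` on `(0, 1]` multiplies by `1 / s` and gives the CDF.
-/

noncomputable section

section VerticalLines

theorem norm_Gamma_le {s : ℂ} (hs : 0 < s.re) : ‖Complex.Gamma s‖ ≤ Real.Gamma s.re := by
  rw [Complex.Gamma_eq_integral hs, Real.Gamma_eq_integral hs, Complex.GammaIntegral]
  refine (norm_integral_le_integral_norm _).trans_eq ?_
  refine setIntegral_congr_fun measurableSet_Ioi fun x (hx : 0 < x) => ?_
  simp [Complex.norm_cpow_eq_rpow_re_of_pos hx, -Complex.ofReal_exp, abs_of_pos (Real.exp_pos _)]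

theorem norm_sq_mul_norm_Gamma_le {s : ℂ} (hs : 0 < s.re) :
    ‖s‖ ^ 2 * ‖Complex.Gamma s‖ ≤ Real.Gamma (s.re + 2) := by
  have ne_zero_of_re_pos : ∀ w : ℂ, 0 < w.re → w ≠ 0 := fun w hw h => by simp [h] at hw
  have hs1 : 0 < (s + 1).re := by simp only [Complex.add_re, Complex.one_re]; linarith
  have norm_le : ‖s‖ ≤ ‖s + 1‖ := by
    simp only [Complex.norm_def, Complex.normSq_apply, Complex.add_re, Complex.add_im,
      Complex.one_re, Complex.one_im, add_zero]
    exact Real.sqrt_le_sqrt (by nlinarith)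
  have recurrence : Complex.Gamma (s + 2) = (s + 1) * (s * Complex.Gamma s) := by
    rw [← Complex.Gamma_add_one s (ne_zero_of_re_pos s hs),
      ← Complex.Gamma_add_one _ (ne_zero_of_re_pos _ hs1), add_assoc, one_add_one_eq_two]
  calc ‖s‖ ^ 2 * ‖Complex.Gamma s‖ = ‖s‖ * (‖s‖ * ‖Complex.Gamma s‖) := by ring
    _ ≤ ‖s + 1‖ * (‖s‖ * ‖Complex.Gamma s‖) := by gcongr
    _ = ‖Complex.Gamma (s + 2)‖ := by rw [recurrence, norm_mul, norm_mul]
    _ ≤ Real.Gamma (s.re + 2) := by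
      have hs2 : 0 < (s + 2).re := by simp only [Complex.add_re, Complex.re_ofNat]; linarith
      simpa using norm_Gamma_le hs2

theorem integrable_inv_sq_add_sq {σ : ℝ} (hσ : σ ≠ 0) :
    Integrable fun t : ℝ => (σ ^ 2 + t ^ 2)⁻¹ := by
  refine ((integrable_inv_one_add_sq.comp_div hσ).const_mul (σ ^ 2)⁻¹).congr
    (ae_of_all _ fun t => ?_)
  simp only
  field_simp

theorem verticalIntegrable_Gamma {σ : ℝ} (hσ : 0 < σ) :
    Complex.VerticalIntegrable Complex.Gamma σ := by
  have re_line (t : ℝ) : ((σ : ℂ) + (t : ℂ) * Complex.I).re = σ := by simp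
  have continuous_line : Continuous fun t : ℝ => Complex.Gamma (σ + t * Complex.I) := by
    refine continuous_iff_continuousAt.2 fun t => ContinuousAt.comp
      (f := fun t : ℝ => (σ : ℂ) + (t : ℂ) * Complex.I)
      (Complex.differentiableAt_Gamma _ fun n h => ?_).continuousAt (by fun_prop)
    have := congrArg Complex.re h
    rw [re_line, Complex.neg_re, Complex.natCast_re] at this
    linarith [n.cast_nonneg (α := ℝ)]
  refine ((integrable_inv_sq_add_sq hσ.ne').const_mul (Real.Gamma (σ + 2))).mono'
    continuous_line.aestronglyMeasurable (ae_of_all _ fun t => ?_)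
  have bound := norm_sq_mul_norm_Gamma_le (s := σ + t * Complex.I) (by rwa [re_line])
  rw [re_line, ← Complex.normSq_eq_norm_sq, Complex.normSq_add_mul_I] at bound
  rw [← div_eq_mul_inv, le_div_iff₀ (by positivity)]
  linarith

end VerticalLines

section MellinBarnes

/-- `k` is represented on `(0, ∞)` by an absolutely convergent Mellin–Barnes integral: it is the
inverse Mellin transform of `G` along the line `Re s = c`. As for the Meijer G-function the
integrand is `G s * z ^ s`, so that `G s` is the Mellin transform of `k` at `-s`. -/
structure HasMellinBarnes (c : ℝ) (k : ℝ → ℝ) (G : ℂ → ℂ) : Prop where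
  verticalIntegrable : Complex.VerticalIntegrable G c
  eq_integral : ∀ z : ℝ, 0 < z → (k z : ℂ) = (1 / (2 * (Real.pi : ℂ))) *
    ∫ t : ℝ, G ((c : ℂ) + (t : ℂ) * Complex.I) * (z : ℂ) ^ ((c : ℂ) + (t : ℂ) * Complex.I)

variable {c : ℝ} {k k' : ℝ → ℝ} {G G' : ℂ → ℂ}

theorem HasMellinBarnes.congr (h : HasMellinBarnes c k G)
    (hG : ∀ s : ℂ, s.re = c → G s = G' s) : HasMellinBarnes c k G' := by
  have on_line : ∀ t : ℝ, G (c + t * Complex.I) = G' (c + t * Complex.I) :=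
    fun t => hG _ (by simp)
  constructor
  · simpa only [Complex.VerticalIntegrable, on_line] using h.verticalIntegrable
  · simpa only [on_line] using h.eq_integral

theorem HasMellinBarnes.eq_of_eq_on_line (h : HasMellinBarnes c k G)
    (h' : HasMellinBarnes c k' G') (hG : ∀ s : ℂ, s.re = c → G s = G' s) {z : ℝ} (hz : 0 < z) :
    k z = k' z :=
  Complex.ofReal_injective (((h.congr hG).eq_integral z hz).trans (h'.eq_integral z hz).symm)

theorem HasMellinBarnes.const_mul (h : HasMellinBarnes c k G) (r : ℝ) :
    HasMellinBarnes c (fun z => r * k z) fun s => r * G s where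
  verticalIntegrable := Integrable.const_mul h.verticalIntegrable _
  eq_integral z hz := by
    simp only [Complex.ofReal_mul, h.eq_integral z hz, mul_assoc, integral_const_mul]
    ring

theorem ofReal_mul_cpow {x y : ℝ} (hx : 0 ≤ x) (hy : 0 ≤ y) (s : ℂ) :
    ((x * y : ℝ) : ℂ) ^ s = (x : ℂ) ^ s * (y : ℂ) ^ s := by
  rw [Complex.ofReal_mul, Complex.mul_cpow_ofReal_nonneg hx hy]

theorem norm_ofReal_cpow_line {x : ℝ} (hx : 0 < x) (c t : ℝ) :
    ‖(x : ℂ) ^ ((c : ℂ) + (t : ℂ) * Complex.I)‖ = x ^ c := by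
  simp [Complex.norm_cpow_eq_rpow_re_of_pos hx]

theorem HasMellinBarnes.comp_mul_left (h : HasMellinBarnes c k G) {r : ℝ} (hr : 0 < r) :
    HasMellinBarnes c (fun z => k (r * z)) fun s => G s * (r : ℂ) ^ s where
  verticalIntegrable := by
    refine Integrable.mul_bdd (c := r ^ c) h.verticalIntegrable
      (Measurable.aestronglyMeasurable (by fun_prop))
      (ae_of_all _ fun t => (norm_ofReal_cpow_line hr c t).le)
  eq_integral z hz := by
    simp only [h.eq_integral _ (mul_pos hr hz), ofReal_mul_cpow hr.le hz.le, mul_assoc]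

theorem HasMellinBarnes.comp_sqrt (h : HasMellinBarnes (2 * c) k G) :
    HasMellinBarnes c (fun z => k (√z)) fun s => 2 * G (2 * s) := by
  have two_mul_line (t : ℝ) : 2 * ((c : ℂ) + t * Complex.I) =
      ((2 * c : ℝ) : ℂ) + ((2 * t : ℝ) : ℂ) * Complex.I := by push_cast; ring
  constructor
  · refine Integrable.const_mul ?_ 2
    simp only [two_mul_line]
    exact Integrable.comp_mul_left' (g := fun t : ℝ => G ((2 * c : ℝ) + t * Complex.I))
      h.verticalIntegrable two_ne_zero
  · intro z hz
    have sqrt_cpow (s : ℂ) : (z : ℂ) ^ s = (√z : ℂ) ^ (2 * s) := by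
      have := Complex.cpow_mul_ofReal_nonneg (Real.sqrt_nonneg z) 2 s
      rwa [Real.rpow_two, Real.sq_sqrt hz.le, Complex.ofReal_ofNat, eq_comm] at this
    rw [h.eq_integral _ (Real.sqrt_pos.2 hz)]
    simp only [sqrt_cpow, two_mul_line, mul_assoc, integral_const_mul]
    rw [Measure.integral_comp_mul_left (fun t : ℝ => G ((2 * c : ℝ) + t * Complex.I) *
        (√z : ℂ) ^ (((2 * c : ℝ) : ℂ) + t * Complex.I)), abs_of_pos (by norm_num),
      Complex.real_smul]
    push_cast
    ring

end MellinBarnes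

section DilationAverage

/-- The average of the dilations `z ↦ k (z * p a)` of `k`, where `a` has distribution `ν`. -/
def dilationAverage {X : Type*} [MeasurableSpace X] (ν : Measure X) (p : X → ℝ) (k : ℝ → ℝ)
    (z : ℝ) : ℝ :=
  ∫ a, k (z * p a) ∂ν

variable {X : Type*} [MeasurableSpace X] {ν : Measure X} {p : X → ℝ} {k : ℝ → ℝ}

theorem measurable_dilationAverage [SFinite ν] (hp : Measurable p) (hk : Measurable k) :
    Measurable (dilationAverage ν p k) :=
  have : Measurable (Function.uncurry fun (z : ℝ) (a : X) => k (z * p a)) :=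
    hk.comp (measurable_fst.mul (hp.comp measurable_snd))
  this.stronglyMeasurable.integral_prod_right.measurable

theorem dilationAverage_nonneg (hp : ∀ᵐ a ∂ν, 0 < p a) (hk : ∀ x, 0 < x → 0 ≤ k x) {z : ℝ}
    (hz : 0 < z) : 0 ≤ dilationAverage ν p k z :=
  integral_nonneg_of_ae <| hp.mono fun _ ha => hk _ (mul_pos hz ha)

variable {c : ℝ} {G : ℂ → ℂ}

theorem HasMellinBarnes.integrable_prod (h : HasMellinBarnes c k G) (hp : Measurable p)
    (hpos : ∀ᵐ a ∂ν, 0 < p a) (hint : Integrable (fun a => p a ^ c) ν) {z : ℝ} (hz : 0 < z) :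
    Integrable (fun x : X × ℝ => G (c + x.2 * Complex.I) *
      ((z * p x.1 : ℝ) : ℂ) ^ ((c : ℂ) + x.2 * Complex.I)) (ν.prod volume) := by
  have bound : Integrable (fun x : X × ℝ => (z ^ c * p x.1 ^ c) * ‖G (c + x.2 * Complex.I)‖)
      (ν.prod volume) :=
    (hint.const_mul (z ^ c)).mul_prod (Integrable.norm h.verticalIntegrable)
  refine bound.mono ((Integrable.aestronglyMeasurable h.verticalIntegrable).comp_snd.mul
    (Measurable.aestronglyMeasurable (by fun_prop))) ?_
  filter_upwards [Measure.quasiMeasurePreserving_fst.ae hpos] with x hx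
  rw [norm_mul, norm_ofReal_cpow_line (mul_pos hz hx), Real.mul_rpow hz.le hx.le, norm_mul,
    norm_norm, Real.norm_of_nonneg (by positivity), mul_comm]

theorem HasMellinBarnes.ofReal_comp_mul_ae (h : HasMellinBarnes c k G)
    (hpos : ∀ᵐ a ∂ν, 0 < p a) {z : ℝ} (hz : 0 < z) :
    (fun a => (k (z * p a) : ℂ)) =ᵐ[ν] fun a => (1 / (2 * (Real.pi : ℂ))) *
      ∫ t : ℝ, G (c + t * Complex.I) * ((z * p a : ℝ) : ℂ) ^ ((c : ℂ) + t * Complex.I) :=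
  hpos.mono fun _ ha => h.eq_integral _ (mul_pos hz ha)

theorem HasMellinBarnes.integrable_comp_mul [SFinite ν] (h : HasMellinBarnes c k G)
    (hp : Measurable p) (hpos : ∀ᵐ a ∂ν, 0 < p a) (hint : Integrable (fun a => p a ^ c) ν) {z : ℝ}
    (hz : 0 < z) :
    Integrable (fun a => k (z * p a)) ν :=
  (((h.integrable_prod hp hpos hint hz).integral_prod_left.const_mul _).congr
    (h.ofReal_comp_mul_ae hpos hz).symm).re

theorem integral_mul_cpow (hpos : ∀ᵐ a ∂ν, 0 < p a) {z : ℝ} (hz : 0 < z)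
    (w s : ℂ) : ∫ a, w * ((z * p a : ℝ) : ℂ) ^ s ∂ν =
      w * (∫ a, (p a : ℂ) ^ s ∂ν) * (z : ℂ) ^ s := by
  rw [integral_const_mul, mul_assoc, mul_comm (∫ a, _ ∂ν), ← integral_const_mul ((z : ℂ) ^ s)]
  congr 1
  exact integral_congr_ae (hpos.mono fun a ha => ofReal_mul_cpow hz.le ha.le s)

theorem hasMellinBarnes_dilationAverage [SFinite ν] (h : HasMellinBarnes c k G) (hp : Measurable p)
    (hpos : ∀ᵐ a ∂ν, 0 < p a) (hint : Integrable (fun a => p a ^ c) ν) :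
    HasMellinBarnes c (dilationAverage ν p k) fun s => G s * ∫ a, (p a : ℂ) ^ s ∂ν where
  verticalIntegrable := by
    refine (h.integrable_prod hp hpos hint one_pos).integral_prod_right.congr
      (ae_of_all _ fun t => ?_)
    simp only [integral_mul_cpow hpos one_pos, Complex.ofReal_one, Complex.one_cpow, mul_one]
  eq_integral z hz := by
    rw [dilationAverage, ← integral_complex_ofReal,
      integral_congr_ae (h.ofReal_comp_mul_ae hpos hz), integral_const_mul,
      integral_integral_swap (h.integrable_prod hp hpos hint hz)]
    simp only [integral_mul_cpow hpos hz]

end DilationAverage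

section MeijerG

theorem ofReal_eq_mul_meijerG {m n p q : ℕ} {a : Fin p → ℂ} {b : Fin q → ℂ} {k : ℝ → ℝ} {w : ℂ}
    (hsep : ∃ c, MeijerSeparates m n a b c)
    (hk : ∀ c, MeijerSeparates m n a b c →
      HasMellinBarnes c k fun s => w * meijerIntegrand m n a b 1 s)
    {z : ℝ} (hz : 0 < z) : (k z : ℂ) = w * meijerG m n a b z := by
  rw [meijerG, dif_pos hsep, (hk _ hsep.choose_spec).eq_integral z hz, mul_left_comm w,
    ← integral_const_mul w]
  simp only [meijerIntegrand, Complex.one_cpow, mul_one, mul_assoc]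

variable {a₁ a₂ b₁ b₂ : ℂ} {c : ℝ}

theorem meijerSeparates_two_two_iff :
    MeijerSeparates 2 2 ![a₁, a₂] ![b₁, b₂] c ↔
      (c < b₁.re ∧ c < b₂.re) ∧ a₁.re - 1 < c ∧ a₂.re - 1 < c := by
  simp [MeijerSeparates, Fin.forall_fin_two]

theorem meijerSeparates_two_three_iff :
    MeijerSeparates 2 3 ![1, a₁, a₂] ![b₁, b₂, 0] c ↔
      0 < c ∧ MeijerSeparates 2 2 ![a₁, a₂] ![b₁, b₂] c := by
  rw [meijerSeparates_two_two_iff]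
  simp [MeijerSeparates, Fin.forall_fin_succ, and_assoc, and_left_comm]

theorem meijerIntegrand_two_two (z s : ℂ) :
    meijerIntegrand 2 2 ![a₁, a₂] ![b₁, b₂] z s =
      Complex.Gamma (b₁ - s) * Complex.Gamma (b₂ - s) *
        (Complex.Gamma (1 - a₁ + s) * Complex.Gamma (1 - a₂ + s)) * z ^ s := by
  simp [meijerIntegrand, Fin.prod_univ_two]

theorem meijerIntegrand_two_three (z : ℂ) {s : ℂ} (hs : 0 < s.re) :
    meijerIntegrand 2 3 ![1, a₁, a₂] ![b₁, b₂, 0] z s =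
      meijerIntegrand 2 2 ![a₁, a₂] ![b₁, b₂] z s * (1 / s) := by
  have hs0 : s ≠ 0 := fun h => by simp [h] at hs
  have hΓ : Complex.Gamma s * (Complex.Gamma (1 + s))⁻¹ = 1 / s := by
    have := Complex.Gamma_ne_zero_of_re_pos hs
    rw [add_comm, Complex.Gamma_add_one s hs0]
    field_simp
  calc meijerIntegrand 2 3 ![1, a₁, a₂] ![b₁, b₂, 0] z s
      = Complex.Gamma (b₁ - s) * (Complex.Gamma (b₂ - s) * (Complex.Gamma (1 + s))⁻¹) *
          (Complex.Gamma s * (Complex.Gamma (1 - a₁ + s) * Complex.Gamma (1 - a₂ + s))) *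
            z ^ s := by simp [meijerIntegrand, Fin.prod_univ_succ]
    _ = meijerIntegrand 2 2 ![a₁, a₂] ![b₁, b₂] z s * (1 / s) := by
      rw [meijerIntegrand_two_two, ← hΓ]
      ring

end MeijerG

section MulDensity

/-- The measure on `(0, ∞)` with density `k` with respect to the Haar measure `dx / x` of the
multiplicative group, for which dilations act on densities without a Jacobian factor. -/
def mulDensity (k : ℝ → ℝ) : Measure ℝ :=
  (volume.restrict (Set.Ioi 0)).withDensity fun x => ENNReal.ofReal (x⁻¹ * k x)

instance (k : ℝ → ℝ) : SFinite (mulDensity k) := by unfold mulDensity; infer_instance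

instance (k : ℝ → ℝ) : NullSingletonClass (mulDensity k) where
  measure_singleton x :=
    withDensity_absolutelyContinuous _ _ (measure_singleton x)

variable {k k' : ℝ → ℝ}

theorem mulDensity_congr (h : ∀ x, 0 < x → k x = k' x) : mulDensity k = mulDensity k' := by
  refine withDensity_congr_ae ?_
  filter_upwards [ae_restrict_mem measurableSet_Ioi] with x (hx : 0 < x)
  rw [h x hx]

theorem ae_pos_mulDensity (k : ℝ → ℝ) : ∀ᵐ x ∂(mulDensity k), 0 < x :=
  (withDensity_absolutelyContinuous _ _).ae_le (ae_restrict_mem measurableSet_Ioi)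

theorem mulDensity_apply (k : ℝ → ℝ) {B : Set ℝ} (hB : MeasurableSet B) :
    mulDensity k B = ∫⁻ x in B ∩ Set.Ioi 0, ENNReal.ofReal (x⁻¹ * k x) := by
  rw [mulDensity, withDensity_apply _ hB, Measure.restrict_restrict hB]

theorem withDensity_ofReal_eq_mulDensity {f : ℝ → ℝ} (hneg : ∀ x < 0, f x = 0)
    (hpos : ∀ x, 0 < x → f x = x⁻¹ * k x) :
    volume.withDensity (fun x => ENNReal.ofReal (f x)) = mulDensity k := by
  rw [mulDensity, ← withDensity_indicator measurableSet_Ioi]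
  refine withDensity_congr_ae ?_
  filter_upwards [Measure.ae_ne volume (0 : ℝ)] with x hx
  rcases hx.lt_or_gt with hx | hx
  · simp [hneg x hx, hx.le]
  · simp [hpos x hx, hx]

theorem mulDensity_eq_withDensity_indicator (k : ℝ → ℝ) : mulDensity k =
    volume.withDensity fun x => ENNReal.ofReal ((Set.Ioi 0).indicator (fun x => x⁻¹ * k x) x) :=
  (withDensity_ofReal_eq_mulDensity
    (f := (Set.Ioi 0).indicator fun x => x⁻¹ * k x)
    (fun _ hx => Set.indicator_of_notMem (Set.notMem_Ioi.2 hx.le) _)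
    fun _ hx => Set.indicator_of_mem (Set.mem_Ioi.2 hx) _).symm

theorem integrable_mulDensity_iff {E : Type*} [NormedAddCommGroup E] [NormedSpace ℝ E]
    (hk : Measurable k) (hk0 : ∀ x, 0 < x → 0 ≤ k x) {f : ℝ → E} :
    Integrable f (mulDensity k) ↔ IntegrableOn (fun x => (x⁻¹ * k x) • f x) (Set.Ioi 0) := by
  rw [mulDensity, integrable_withDensity_iff_integrable_smul' (by fun_prop) (by simp)]
  refine integrableOn_congr_fun (fun x (hx : 0 < x) => ?_) measurableSet_Ioi
  rw [ENNReal.toReal_ofReal (mul_nonneg (inv_nonneg.2 hx.le) (hk0 x hx))]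

theorem integral_mulDensity {E : Type*} [NormedAddCommGroup E] [NormedSpace ℝ E]
    (hk : Measurable k) (hk0 : ∀ x, 0 < x → 0 ≤ k x) (f : ℝ → E) :
    ∫ x, f x ∂(mulDensity k) = ∫ x in Set.Ioi 0, (x⁻¹ * k x) • f x := by
  rw [mulDensity, integral_withDensity_eq_integral_toReal_smul (by fun_prop) (by simp)]
  refine setIntegral_congr_fun measurableSet_Ioi fun x (hx : 0 < x) => ?_
  simp only [ENNReal.toReal_ofReal (mul_nonneg (inv_nonneg.2 hx.le) (hk0 x hx))]

theorem integral_mulDensity_sum {ι E : Type*} [NormedAddCommGroup E] [NormedSpace ℝ E]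
    {s : Finset ι} {w : ι → ℝ} {h : ι → ℝ → ℝ} (hh : ∀ i ∈ s, Measurable (h i))
    (hh0 : ∀ i ∈ s, ∀ x, 0 < x → 0 ≤ h i x) (hk : Measurable k) (hk0 : ∀ x, 0 < x → 0 ≤ k x)
    (hsum : ∀ x, 0 < x → k x = ∑ i ∈ s, w i * h i x) {f : ℝ → E}
    (hf : ∀ i ∈ s, Integrable f (mulDensity (h i))) :
    ∫ x, f x ∂(mulDensity k) = ∑ i ∈ s, w i • ∫ x, f x ∂(mulDensity (h i)) := by
  have term_eq : ∀ i ∈ s, w i • ∫ x, f x ∂(mulDensity (h i)) =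
      ∫ x in Set.Ioi 0, w i • (x⁻¹ * h i x) • f x := fun i hi => by
    rw [integral_mulDensity (hh i hi) (hh0 i hi), integral_smul]
  have term_integrable : ∀ i ∈ s,
      IntegrableOn (fun x => w i • (x⁻¹ * h i x) • f x) (Set.Ioi 0) := fun i hi =>
    ((integrable_mulDensity_iff (hh i hi) (hh0 i hi)).1 (hf i hi)).smul (w i)
  rw [Finset.sum_congr rfl term_eq, ← integral_finsetSum s term_integrable,
    integral_mulDensity hk hk0]
  refine setIntegral_congr_fun measurableSet_Ioi fun x (hx : 0 < x) => ?_
  simp only [hsum x hx, Finset.mul_sum, Finset.sum_smul, smul_smul, mul_left_comm]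

theorem mulDensity_mul_withDensity (hk : Measurable k) {f : ℝ → ℝ} (hf : Measurable f)
    (hk0 : ∀ x, 0 < x → 0 ≤ k x) :
    (mulDensity k).withDensity (fun x => ENNReal.ofReal (f x)) =
      mulDensity fun x => f x * k x := by
  rw [mulDensity, mulDensity, ← withDensity_mul _ (by fun_prop) (by fun_prop)]
  refine withDensity_congr_ae ?_
  filter_upwards [ae_restrict_mem measurableSet_Ioi] with x (hx : 0 < x)
  rw [Pi.mul_apply, ← ENNReal.ofReal_mul (mul_nonneg (inv_nonneg.2 hx.le) (hk0 x hx))]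
  ring_nf

theorem map_mulDensity_comp {φ φ' : ℝ → ℝ} (hφ : Measurable φ)
    (hbij : Set.BijOn φ (Set.Ioi 0) (Set.Ioi 0))
    (hderiv : ∀ x, 0 < x → HasDerivAt φ (φ' x) x) (k : ℝ → ℝ) :
    (mulDensity fun x => |x * φ' x / φ x| * k (φ x)).map φ = mulDensity k := by
  ext B hB
  have image_eq : φ '' (φ ⁻¹' B ∩ Set.Ioi 0) = B ∩ Set.Ioi 0 := by
    rw [Set.image_preimage_inter, hbij.image_eq]
  have hmeas : MeasurableSet (φ ⁻¹' B ∩ Set.Ioi 0) := (hφ hB).inter measurableSet_Ioi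
  rw [Measure.map_apply hφ hB, mulDensity_apply _ (hφ hB), mulDensity_apply _ hB, ← image_eq,
    lintegral_image_eq_lintegral_abs_deriv_mul hmeas
      (fun x hx => (hderiv x hx.2).hasDerivWithinAt) (hbij.injOn.mono Set.inter_subset_right)]
  refine setLIntegral_congr_fun hmeas fun x hx => ?_
  have hx0 : 0 < x := hx.2
  have hφx : 0 < φ x := hbij.mapsTo hx.2
  rw [← ENNReal.ofReal_mul (abs_nonneg _), abs_div, abs_mul, abs_of_pos hx0, abs_of_pos hφx]
  congr 1
  field_simp

theorem map_mul_left_mulDensity (k : ℝ → ℝ) {r : ℝ} (hr : 0 < r) :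
    (mulDensity fun x => k (r * x)).map (fun x => r * x) = mulDensity k := by
  have hbij : Set.BijOn (fun x => r * x) (Set.Ioi 0) (Set.Ioi (0 : ℝ)) :=
    ⟨fun x hx => mul_pos hr hx, (mul_right_injective₀ hr.ne').injOn,
      fun x hx => ⟨r⁻¹ * x, mul_pos (inv_pos.2 hr) hx, mul_inv_cancel_left₀ hr.ne' x⟩⟩
  refine (congrArg (Measure.map _) (mulDensity_congr fun x hx => ?_)).trans
    (map_mulDensity_comp (by fun_prop) hbij (fun x _ => hasDerivAt_const_mul r) k)
  rw [mul_comm x r, div_self (mul_pos hr hx).ne', abs_one, one_mul]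

theorem map_const_div_mulDensity (k : ℝ → ℝ) {r : ℝ} (hr : 0 < r) :
    (mulDensity fun x => k (r / x)).map (fun x => r / x) = mulDensity k := by
  have hbij : Set.BijOn (fun x => r / x) (Set.Ioi 0) (Set.Ioi (0 : ℝ)) :=
    ⟨fun x hx => div_pos hr hx, fun x hx y hy h => by
      have hx' : x ≠ 0 := ne_of_gt hx
      have hy' : y ≠ 0 := ne_of_gt hy
      field_simp at h
      exact h.symm,
      fun x hx => ⟨r / x, div_pos hr hx, div_div_cancel₀ hr.ne'⟩⟩
  refine (congrArg (Measure.map _) (mulDensity_congr fun x hx => ?_)).trans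
    (map_mulDensity_comp (by fun_prop) hbij
      (fun x hx => (hasDerivAt_inv hx.ne').const_mul r) k)
  have : x * (r * -(x ^ 2)⁻¹) / (r / x) = -1 := by field_simp
  rw [this, abs_neg, abs_one, one_mul]

theorem map_two_mul_sqrt_mulDensity (k : ℝ → ℝ) :
    (mulDensity fun x => 1 / 2 * k (2 * √x)).map (fun x => 2 * √x) = mulDensity k := by
  have hbij : Set.BijOn (fun x => 2 * √x) (Set.Ioi 0) (Set.Ioi (0 : ℝ)) :=
    ⟨fun x hx => mul_pos two_pos (Real.sqrt_pos.2 hx), fun x hx y hy h =>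
      (Real.sqrt_inj (le_of_lt hx) (le_of_lt hy)).1 (mul_left_cancel₀ two_ne_zero h),
      fun x (hx : 0 < x) => ⟨(x / 2) ^ 2, pow_pos (half_pos hx) 2, by
        simp only [Real.sqrt_sq (half_pos hx).le]
        ring⟩⟩
  refine (congrArg (Measure.map _) (mulDensity_congr fun x hx => ?_)).trans
    (map_mulDensity_comp (by fun_prop) hbij
      (fun x hx => (Real.hasDerivAt_sqrt hx.ne').const_mul 2) k)
  have hsqrt : √x ≠ 0 := (Real.sqrt_pos.2 hx).ne'
  have jacobian_eq : x * (2 * (1 / (2 * √x))) / (2 * √x) = 1 / 2 := by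
    field_simp [hsqrt]
    exact (Real.sq_sqrt hx.le).symm
  rw [jacobian_eq, abs_of_pos one_half_pos]

variable {X : Type*} [MeasurableSpace X] {P : Measure X} {p : X → ℝ}

theorem ofReal_inv_mul_dilationAverage (hk0 : ∀ x, 0 < x → 0 ≤ k x)
    (hpos : ∀ᵐ a ∂P, 0 < p a) {x : ℝ} (hx : 0 < x) (hint : Integrable (fun a => k (x * p a)) P) :
    ENNReal.ofReal (x⁻¹ * dilationAverage P p k x) =
      ∫⁻ a, ENNReal.ofReal (x⁻¹ * k (x * p a)) ∂P := by
  rw [dilationAverage, ← integral_const_mul, ofReal_integral_eq_lintegral_ofReal (hint.const_mul _)]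
  filter_upwards [hpos] with a ha
  exact mul_nonneg (inv_nonneg.2 hx.le) (hk0 _ (mul_pos hx ha))

theorem map_div_mulDensity_prod [SFinite P] (hk : Measurable k) (hk0 : ∀ x, 0 < x → 0 ≤ k x)
    (hp : Measurable p) (hpos : ∀ᵐ a ∂P, 0 < p a)
    (hint : ∀ x, 0 < x → Integrable (fun a => k (x * p a)) P) :
    ((mulDensity k).prod P).map (fun q => q.1 / p q.2) = mulDensity (dilationAverage P p k) := by
  have hdiv : Measurable fun q : ℝ × X => q.1 / p q.2 := by fun_prop
  ext B hB
  have slice : ∀ᵐ a ∂P, mulDensity k ((fun x => (x, a)) ⁻¹' ((fun q => q.1 / p q.2) ⁻¹' B)) =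
      ∫⁻ x in B ∩ Set.Ioi 0, ENNReal.ofReal (x⁻¹ * k (x * p a)) := by
    filter_upwards [hpos] with a ha
    have := map_mul_left_mulDensity (fun x => k (x * p a)) (inv_pos.2 ha)
    simp only [mul_comm (p a)⁻¹, inv_mul_cancel_right₀ ha.ne'] at this
    rw [← mulDensity_apply _ hB, ← this, Measure.map_apply (by fun_prop) hB]
    rfl
  rw [Measure.map_apply hdiv hB, Measure.prod_apply_symm (hdiv hB), lintegral_congr_ae slice,
    lintegral_lintegral_swap (Measurable.aemeasurable (by unfold Function.uncurry; fun_prop)),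
    mulDensity_apply _ hB]
  exact (setLIntegral_congr_fun (hB.inter measurableSet_Ioi) fun x hx =>
    ofReal_inv_mul_dilationAverage hk0 hpos hx.2 (hint x hx.2)).symm

end MulDensity

section Mellin

variable {c : ℝ} {k : ℝ → ℝ}

theorem hasMellinBarnes_mellin (hk : ContinuousOn k (Set.Ioi 0))
    (hconv : MellinConvergent (fun x => (k x : ℂ)) ((-c : ℝ) : ℂ))
    (hint : Complex.VerticalIntegrable (fun s => mellin (fun x => (k x : ℂ)) (-s)) c) :
    HasMellinBarnes c k fun s => mellin (fun x => (k x : ℂ)) (-s) where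
  verticalIntegrable := hint
  eq_integral z hz := by
    have neg_line (t : ℝ) : -((c : ℂ) + ((-t : ℝ) : ℂ) * Complex.I) =
        ((-c : ℝ) : ℂ) + t * Complex.I := by push_cast; ring
    have vertical : Complex.VerticalIntegrable (mellin fun x => (k x : ℂ)) (-c) := by
      simpa only [Complex.VerticalIntegrable, neg_line] using Integrable.comp_neg hint
    have continuousAt : ContinuousAt (fun x => (k x : ℂ)) z :=
      Complex.continuous_ofReal.continuousAt.comp (hk.continuousAt (Ioi_mem_nhds hz))
    rw [← mellinInv_mellin_eq (-c) (fun x => (k x : ℂ)) hz hconv vertical continuousAt,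
      mellinInv, Complex.real_smul, ← integral_neg_eq_self fun t : ℝ => _ * (z : ℂ) ^ _]
    push_cast
    congr 1
    refine integral_congr_ae (ae_of_all _ fun t => ?_)
    simp only [smul_eq_mul, mul_comm (mellin _ _)]
    ring_nf

theorem inv_mul_smul_cpow (k : ℝ → ℝ) {x : ℝ} (hx : 0 < x) (s : ℂ) :
    (x⁻¹ * k x) • (x : ℂ) ^ s = (x : ℂ) ^ (s - 1) • (k x : ℂ) := by
  have hx' : (x : ℂ) ≠ 0 := Complex.ofReal_ne_zero.2 hx.ne'
  rw [Complex.cpow_sub _ _ hx', Complex.cpow_one, Complex.real_smul, smul_eq_mul]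
  push_cast
  ring

variable (hk : Measurable k) (hk0 : ∀ x, 0 < x → 0 ≤ k x) {s : ℂ}
include hk hk0

theorem integral_cpow_mulDensity :
    ∫ x, (x : ℂ) ^ s ∂(mulDensity k) = mellin (fun x => (k x : ℂ)) s := by
  rw [integral_mulDensity hk hk0, mellin]
  exact setIntegral_congr_fun measurableSet_Ioi fun x hx => inv_mul_smul_cpow k hx s

theorem integrable_cpow_mulDensity_iff :
    Integrable (fun x : ℝ => (x : ℂ) ^ s) (mulDensity k) ↔
      MellinConvergent (fun x => (k x : ℂ)) s := by
  rw [integrable_mulDensity_iff hk hk0, MellinConvergent]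
  exact integrableOn_congr_fun (fun x hx => inv_mul_smul_cpow k hx s) measurableSet_Ioi

theorem integrable_rpow_mulDensity {c : ℝ}
    (h : MellinConvergent (fun x => (k x : ℂ)) (c : ℂ)) :
    Integrable (fun x => x ^ c) (mulDensity k) := by
  refine ((integrable_cpow_mulDensity_iff hk hk0).2 h).norm.congr ?_
  filter_upwards [ae_pos_mulDensity k] with x hx
  rw [Complex.norm_cpow_eq_rpow_re_of_pos hx, Complex.ofReal_re]

end Mellin

section GammaKernel

/-- The density `x ^ a * exp (-x) / Γ(a)` of the gamma distribution of shape `a` and rate `1` with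
respect to `dx / x`. -/
def gammaKernel (a x : ℝ) : ℝ := x ^ a * Real.exp (-x) / Real.Gamma a

@[fun_prop]
theorem measurable_gammaKernel (a : ℝ) : Measurable (gammaKernel a) := by
  unfold gammaKernel
  fun_prop

theorem continuousOn_gammaKernel (a : ℝ) : ContinuousOn (gammaKernel a) (Set.Ioi 0) :=
  ((continuousOn_id.rpow_const fun _ hx => Or.inl (ne_of_gt hx)).mul (by fun_prop)).div_const _

variable {a c r : ℝ}

theorem gammaKernel_nonneg (ha : 0 < a) {x : ℝ} (hx : 0 < x) : 0 ≤ gammaKernel a x := by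
  have := Real.Gamma_pos_of_pos ha
  unfold gammaKernel
  positivity

theorem cpow_smul_gammaKernel (a : ℝ) {x : ℝ} (hx : 0 < x) (s : ℂ) :
    (x : ℂ) ^ (s - 1) • (gammaKernel a x : ℂ) =
      (Real.exp (-x) : ℂ) * (x : ℂ) ^ (a + s - 1) / Complex.Gamma a := by
  rw [gammaKernel, Complex.ofReal_div, Complex.ofReal_mul, Complex.ofReal_cpow hx.le,
    Complex.Gamma_ofReal, smul_eq_mul, add_sub_assoc,
    Complex.cpow_add _ _ (Complex.ofReal_ne_zero.2 hx.ne')]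
  ring

theorem mellinConvergent_gammaKernel {s : ℂ} (hs : 0 < a + s.re) :
    MellinConvergent (fun x => (gammaKernel a x : ℂ)) s :=
  IntegrableOn.congr_fun
    (Integrable.div_const (Complex.GammaIntegral_convergent (s := a + s) (by simpa using hs)) _)
    (fun _ hx => (cpow_smul_gammaKernel a hx s).symm) measurableSet_Ioi

theorem mellin_gammaKernel {s : ℂ} (hs : 0 < a + s.re) :
    mellin (fun x => (gammaKernel a x : ℂ)) s = Complex.Gamma (a + s) / Complex.Gamma a := by
  rw [mellin, setIntegral_congr_fun measurableSet_Ioi fun x hx => cpow_smul_gammaKernel a hx s,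
    integral_div, ← Complex.GammaIntegral, ← Complex.Gamma_eq_integral (by simpa using hs)]

theorem hasMellinBarnes_gammaKernel (hc : c < a) :
    HasMellinBarnes c (gammaKernel a) fun s => Complex.Gamma (a - s) / Complex.Gamma a := by
  have mellin_eq : ∀ s : ℂ, s.re = c → mellin (fun x => (gammaKernel a x : ℂ)) (-s) =
      Complex.Gamma (a - s) / Complex.Gamma a := fun s hs => by
    rw [mellin_gammaKernel (by rw [Complex.neg_re]; linarith), sub_eq_add_neg]
  have vertical : Complex.VerticalIntegrable
      (fun s => mellin (fun x => (gammaKernel a x : ℂ)) (-s)) c := by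
    refine ((verticalIntegrable_Gamma (sub_pos.2 hc)).comp_neg.div_const
      (Complex.Gamma a)).congr (ae_of_all _ fun t => ?_)
    simp only [mellin_eq _ (show ((c : ℂ) + t * Complex.I).re = c by simp)]
    push_cast
    ring_nf
  exact (hasMellinBarnes_mellin (continuousOn_gammaKernel a)
    (mellinConvergent_gammaKernel (by simpa using hc)) vertical).congr mellin_eq

theorem gammaMeasure_eq_mulDensity (a : ℝ) (hr : 0 < r) :
    gammaMeasure a r = mulDensity fun x => gammaKernel a (r * x) := by
  refine withDensity_ofReal_eq_mulDensity (fun x hx => if_neg hx.not_ge) fun x hx => ?_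
  rw [gammaPDFReal, if_pos hx.le, gammaKernel, Real.mul_rpow hr.le hx.le, Real.rpow_sub_one hx.ne']
  ring

theorem gammaMeasure_one_eq_mulDensity (a : ℝ) : gammaMeasure a 1 = mulDensity (gammaKernel a) := by
  simpa only [one_mul] using gammaMeasure_eq_mulDensity a one_pos

theorem invGammaMeasure_eq_mulDensity (a : ℝ) (hr : 0 < r) :
    invGammaMeasure a r = mulDensity fun y => gammaKernel a (r / y) := by
  refine withDensity_ofReal_eq_mulDensity (fun y hy => if_neg hy.not_gt) fun y hy => ?_
  rw [invGammaPDFReal, if_pos hy, gammaKernel, Real.div_rpow hr.le hy.le,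
    Real.rpow_add_one hy.ne']
  field_simp

instance (a r : ℝ) : SFinite (gammaMeasure a r) := by unfold gammaMeasure; infer_instance

instance (a r : ℝ) : NullSingletonClass (gammaMeasure a r) where
  measure_singleton x := withDensity_absolutelyContinuous _ _ (measure_singleton x)

theorem ae_pos_gammaMeasure (a : ℝ) (hr : 0 < r) : ∀ᵐ x ∂(gammaMeasure a r), 0 < x := by
  rw [gammaMeasure_eq_mulDensity a hr]
  exact ae_pos_mulDensity _

theorem map_mul_left_gammaMeasure (a : ℝ) (hr : 0 < r) :
    (gammaMeasure a r).map (fun x => r * x) = gammaMeasure a 1 := by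
  rw [gammaMeasure_eq_mulDensity a hr, map_mul_left_mulDensity _ hr,
    gammaMeasure_one_eq_mulDensity]

theorem map_const_div_invGammaMeasure (a : ℝ) (hr : 0 < r) :
    (invGammaMeasure a r).map (fun y => r / y) = gammaMeasure a 1 := by
  rw [invGammaMeasure_eq_mulDensity a hr, map_const_div_mulDensity _ hr,
    gammaMeasure_one_eq_mulDensity]

theorem integrable_rpow_gammaMeasure (ha : 0 < a) (hc : 0 < a + c) :
    Integrable (fun x => x ^ c) (gammaMeasure a 1) := by
  rw [gammaMeasure_one_eq_mulDensity]
  exact integrable_rpow_mulDensity (measurable_gammaKernel a) (fun _ => gammaKernel_nonneg ha)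
    (mellinConvergent_gammaKernel (by simpa using hc))

theorem integral_cpow_gammaMeasure (ha : 0 < a) {s : ℂ} (hs : 0 < a + s.re) :
    ∫ x, (x : ℂ) ^ s ∂(gammaMeasure a 1) = Complex.Gamma (a + s) / Complex.Gamma a := by
  rw [gammaMeasure_one_eq_mulDensity, integral_cpow_mulDensity (measurable_gammaKernel a)
    (fun _ => gammaKernel_nonneg ha), mellin_gammaKernel hs]

end GammaKernel

section GammaProduct

/-- The density, with respect to `dx / x`, of the product of two independent gamma variables of
shapes `a` and `b` and rate `1`. -/
def gammaProdKernel (a b : ℝ) : ℝ → ℝ :=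
  dilationAverage (gammaMeasure b 1) (fun u => u⁻¹) (gammaKernel a)

@[fun_prop]
theorem measurable_gammaProdKernel (a b : ℝ) : Measurable (gammaProdKernel a b) :=
  measurable_dilationAverage measurable_inv (measurable_gammaKernel a)

variable {a b c : ℝ}

theorem ae_inv_pos_gammaMeasure (a : ℝ) : ∀ᵐ u ∂(gammaMeasure a 1), 0 < u⁻¹ :=
  (ae_pos_gammaMeasure a one_pos).mono fun _ hu => inv_pos.2 hu

theorem gammaProdKernel_nonneg (b : ℝ) (ha : 0 < a) {x : ℝ} (hx : 0 < x) :
    0 ≤ gammaProdKernel a b x :=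
  dilationAverage_nonneg (ae_inv_pos_gammaMeasure b) (fun _ => gammaKernel_nonneg ha) hx

theorem integrable_inv_rpow_gammaMeasure (hb : 0 < b) (hc : c < b) :
    Integrable (fun u => u⁻¹ ^ c) (gammaMeasure b 1) := by
  refine (integrable_rpow_gammaMeasure hb (c := -c) (by linarith)).congr ?_
  filter_upwards [ae_pos_gammaMeasure b one_pos] with u hu
  rw [Real.rpow_neg hu.le, Real.inv_rpow hu.le]

theorem integral_inv_cpow_gammaMeasure (hb : 0 < b) {s : ℂ} (hs : s.re < b) :
    ∫ u, ((u⁻¹ : ℝ) : ℂ) ^ s ∂(gammaMeasure b 1) = Complex.Gamma (b - s) / Complex.Gamma b := by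
  have neg_cpow : (fun u : ℝ => ((u⁻¹ : ℝ) : ℂ) ^ s) =ᵐ[gammaMeasure b 1]
      fun u => (u : ℂ) ^ (-s) := by
    filter_upwards [ae_pos_gammaMeasure b one_pos] with u hu
    rw [Complex.ofReal_inv, Complex.inv_cpow _ _ (by
      rw [Complex.arg_ofReal_of_nonneg hu.le]; exact Real.pi_pos.ne), Complex.cpow_neg]
  rw [integral_congr_ae neg_cpow, integral_cpow_gammaMeasure hb (by simpa using hs), sub_eq_add_neg]

theorem hasMellinBarnes_gammaProdKernel (hb : 0 < b) (hca : c < a) (hcb : c < b) :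
    HasMellinBarnes c (gammaProdKernel a b) fun s =>
      Complex.Gamma (a - s) / Complex.Gamma a * (Complex.Gamma (b - s) / Complex.Gamma b) :=
  (hasMellinBarnes_dilationAverage (hasMellinBarnes_gammaKernel hca) measurable_inv
    (ae_inv_pos_gammaMeasure b) (integrable_inv_rpow_gammaMeasure hb hcb)).congr fun s hs => by
      rw [integral_inv_cpow_gammaMeasure hb (hs.trans_lt hcb)]

theorem mconv_gammaMeasure (ha : 0 < a) (hb : 0 < b) :
    gammaMeasure a 1 ∗ₘ gammaMeasure b 1 = mulDensity (gammaProdKernel a b) := by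
  have integrable (x : ℝ) (hx : 0 < x) :
      Integrable (fun u => gammaKernel a (x * u⁻¹)) (gammaMeasure b 1) :=
    (hasMellinBarnes_gammaKernel ha).integrable_comp_mul measurable_inv
      (ae_inv_pos_gammaMeasure b) (integrable_inv_rpow_gammaMeasure hb hb) hx
  have := map_div_mulDensity_prod (measurable_gammaKernel a) (fun _ => gammaKernel_nonneg ha)
    measurable_inv (ae_inv_pos_gammaMeasure b) integrable
  simp only [div_inv_eq_mul] at this
  rw [Measure.mconv, gammaMeasure_one_eq_mulDensity a, this, gammaProdKernel]

theorem Gamma_sub_div_Gamma_duplication (ha : 0 < a) (s : ℂ) :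
    Complex.Gamma (a - s) / Complex.Gamma a *
        (Complex.Gamma ((a + 1 / 2 : ℝ) - s) / Complex.Gamma (a + 1 / 2 : ℝ)) =
      Complex.Gamma ((2 * a : ℝ) - 2 * s) / Complex.Gamma (2 * a : ℝ) * 2 ^ (2 * s) := by
  have hΓ : Complex.Gamma (2 * a) ≠ 0 :=
    Complex.Gamma_ne_zero_of_re_pos (by simpa using ha)
  have hpi : (√Real.pi : ℂ) ≠ 0 := by
    exact_mod_cast (Real.sqrt_pos.2 Real.pi_pos).ne'
  have hpow : (2 : ℂ) ^ (1 - 2 * (a - s)) = 2 ^ (1 - 2 * (a : ℂ)) * 2 ^ (2 * s) := by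
    rw [← Complex.cpow_add _ _ two_ne_zero]
    ring_nf
  have hpow_ne : (2 : ℂ) ^ (1 - 2 * (a : ℂ)) ≠ 0 := by simp [Complex.cpow_eq_zero_iff]
  push_cast
  rw [div_mul_div_comm, add_sub_right_comm, Complex.Gamma_mul_Gamma_add_half,
    Complex.Gamma_mul_Gamma_add_half, hpow, mul_sub]
  field_simp

theorem gammaProdKernel_add_half (ha : 0 < a) {x : ℝ} (hx : 0 < x) :
    gammaProdKernel a (a + 1 / 2) x = 1 / 2 * gammaKernel (2 * a) (2 * √x) := by
  have sqrt_rep := (((hasMellinBarnes_gammaKernel (show 2 * 0 < 2 * a by linarith)).comp_mul_left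
    two_pos).comp_sqrt).const_mul (1 / 2)
  refine (hasMellinBarnes_gammaProdKernel (by linarith) ha (by linarith)).eq_of_eq_on_line
    sqrt_rep (fun s _ => ?_) hx
  rw [Gamma_sub_div_Gamma_duplication ha]
  push_cast
  ring

theorem map_two_mul_sqrt_mconv_gammaMeasure (ha : 0 < a) :
    (gammaMeasure a 1 ∗ₘ gammaMeasure (a + 1 / 2) 1).map (fun x => 2 * √x) =
      gammaMeasure (2 * a) 1 := by
  rw [mconv_gammaMeasure ha (by linarith), gammaMeasure_one_eq_mulDensity (2 * a),
    ← map_two_mul_sqrt_mulDensity (gammaKernel (2 * a)),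
    mulDensity_congr fun _ => gammaProdKernel_add_half ha]

end GammaProduct

section GammaRatio

/-- The density, with respect to `dx / x`, of `V / (U ^ 2 / 4)`, where `V` is the product of two
gamma variables of shapes `a` and `b`, `U` is a gamma variable of shape `k`, and all three are
independent of rate `1`. -/
def gammaRatioKernel (a b k : ℝ) : ℝ → ℝ :=
  dilationAverage (gammaMeasure k 1) (fun u => u ^ 2 / 4) (gammaProdKernel a b)

@[fun_prop]
theorem measurable_gammaRatioKernel (a b k : ℝ) : Measurable (gammaRatioKernel a b k) :=
  measurable_dilationAverage (by fun_prop) (by fun_prop)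

/-- The factor relating `gammaRatioKernel a b k` to a Meijer G-function: the duplication formula
contributes `2 ^ (k - 1) / √π`, the gamma densities contribute the rest. -/
def gammaRatioConst (a b k : ℝ) : ℝ :=
  2 ^ (k - 1) / (√Real.pi * Real.Gamma a * Real.Gamma b * Real.Gamma k)

variable {a b c k : ℝ}

theorem ae_sq_div_four_pos_gammaMeasure (k : ℝ) {l : ℝ} (hl : 0 < l) :
    ∀ᵐ u ∂(gammaMeasure k l), 0 < u ^ 2 / 4 :=
  (ae_pos_gammaMeasure k hl).mono fun _ hu => by positivity

theorem integrable_sq_div_four_rpow_gammaMeasure (hk : 0 < k) (hc : 0 < k + 2 * c) :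
    Integrable (fun u => (u ^ 2 / 4) ^ c) (gammaMeasure k 1) := by
  refine ((integrable_rpow_gammaMeasure hk hc).div_const (4 ^ c)).congr ?_
  filter_upwards [ae_pos_gammaMeasure k one_pos] with u hu
  rw [Real.div_rpow (sq_nonneg u) (by norm_num), Real.rpow_mul hu.le, Real.rpow_two]

theorem sq_div_four_cpow {u : ℝ} (hu : 0 < u) (s : ℂ) :
    ((u ^ 2 / 4 : ℝ) : ℂ) ^ s = (u : ℂ) ^ (2 * s) / 2 ^ (2 * s) := by
  have := Complex.cpow_mul_ofReal_nonneg (half_pos hu).le 2 s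
  rw [Real.rpow_two, Complex.ofReal_ofNat] at this
  rw [show u ^ 2 / 4 = (u / 2) ^ 2 by ring, ← this, Complex.ofReal_div,
    Complex.div_cpow_ofReal_nonneg hu.le zero_le_two, Complex.ofReal_ofNat]

theorem integral_sq_div_four_cpow_gammaMeasure (hk : 0 < k) {s : ℂ} (hs : 0 < k + 2 * s.re) :
    ∫ u, ((u ^ 2 / 4 : ℝ) : ℂ) ^ s ∂(gammaMeasure k 1) =
      Complex.Gamma (k + 2 * s) / Complex.Gamma k / 2 ^ (2 * s) := by
  rw [integral_congr_ae ((ae_pos_gammaMeasure k one_pos).mono fun u hu => sq_div_four_cpow hu s),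
    integral_div, integral_cpow_gammaMeasure hk (by simpa using hs)]

theorem Gamma_add_two_mul_div_two_cpow (k : ℝ) (s : ℂ) :
    Complex.Gamma (k + 2 * s) / 2 ^ (2 * s) = ((2 ^ (k - 1) / √Real.pi : ℝ) : ℂ) *
      (Complex.Gamma (k / 2 + s) * Complex.Gamma (k / 2 + s + 1 / 2)) := by
  have hpi : (√Real.pi : ℂ) ≠ 0 := by
    exact_mod_cast (Real.sqrt_pos.2 Real.pi_pos).ne'
  have hpow : (2 : ℂ) ^ ((k : ℂ) - 1) * 2 ^ (1 - (k + 2 * s)) = (2 ^ (2 * s))⁻¹ := by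
    rw [← Complex.cpow_add _ _ two_ne_zero, ← Complex.cpow_neg]
    ring_nf
  rw [Complex.Gamma_mul_Gamma_add_half, show 2 * ((k : ℂ) / 2 + s) = k + 2 * s by ring,
    div_eq_mul_inv, ← hpow]
  push_cast [Complex.ofReal_cpow zero_le_two]
  field_simp

theorem hasMellinBarnes_gammaRatioKernel (hb : 0 < b) (hk : 0 < k)
    (hsep : MeijerSeparates 2 2 ![(((1 - k) / 2 : ℝ) : ℂ), (((2 - k) / 2 : ℝ) : ℂ)]
      ![(a : ℂ), (b : ℂ)] c) :
    HasMellinBarnes c (gammaRatioKernel a b k) fun s => gammaRatioConst a b k *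
      meijerIntegrand 2 2 ![(((1 - k) / 2 : ℝ) : ℂ), (((2 - k) / 2 : ℝ) : ℂ)]
        ![(a : ℂ), (b : ℂ)] 1 s := by
  obtain ⟨⟨hca, hcb⟩, -, hck⟩ := meijerSeparates_two_two_iff.1 hsep
  rw [Complex.ofReal_re] at hca hcb hck
  have hck' : 0 < k + 2 * c := by linarith
  refine (hasMellinBarnes_dilationAverage (hasMellinBarnes_gammaProdKernel hb hca hcb)
    (by fun_prop) (ae_sq_div_four_pos_gammaMeasure k one_pos)
    (integrable_sq_div_four_rpow_gammaMeasure hk hck')).congr fun s hs => ?_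
  rw [integral_sq_div_four_cpow_gammaMeasure hk (hs ▸ hck'), div_right_comm,
    Gamma_add_two_mul_div_two_cpow, meijerIntegrand_two_two, Complex.one_cpow, gammaRatioConst,
    show 1 - (((1 - k) / 2 : ℝ) : ℂ) + s = k / 2 + s + 1 / 2 by push_cast; ring,
    show 1 - (((2 - k) / 2 : ℝ) : ℂ) + s = k / 2 + s by push_cast; ring]
  simp only [Complex.ofReal_div, Complex.ofReal_mul, Complex.Gamma_ofReal]
  ring

theorem exists_meijerSeparates_gammaRatio (ha : 0 < a) (hb : 0 < b) (hk : 0 < k) :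
    ∃ c, 0 < c ∧ MeijerSeparates 2 2 ![(((1 - k) / 2 : ℝ) : ℂ), (((2 - k) / 2 : ℝ) : ℂ)]
      ![(a : ℂ), (b : ℂ)] c := by
  obtain ⟨c, hc, hcab⟩ := exists_between (lt_min ha hb)
  obtain ⟨hca, hcb⟩ := lt_min_iff.1 hcab
  refine ⟨c, hc, meijerSeparates_two_two_iff.2 ?_⟩
  simp only [Complex.ofReal_re]
  exact ⟨⟨hca, hcb⟩, by linarith, by linarith⟩

theorem ofReal_gammaRatioKernel (ha : 0 < a) (hb : 0 < b) (hk : 0 < k) {z : ℝ} (hz : 0 < z) :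
    (gammaRatioKernel a b k z : ℂ) = gammaRatioConst a b k *
      meijerG 2 2 ![(((1 - k) / 2 : ℝ) : ℂ), (((2 - k) / 2 : ℝ) : ℂ)] ![(a : ℂ), (b : ℂ)] z := by
  obtain ⟨c, -, hc⟩ := exists_meijerSeparates_gammaRatio ha hb hk
  exact ofReal_eq_mul_meijerG ⟨c, hc⟩ (fun _ => hasMellinBarnes_gammaRatioKernel hb hk) hz

theorem integrable_gammaProdKernel_comp (ha : 0 < a) (hb : 0 < b) (hk : 0 < k) {l z : ℝ}
    (hl : 0 < l) (hz : 0 < z) :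
    Integrable (fun u => gammaProdKernel a b (z * (u ^ 2 / 4))) (gammaMeasure k l) := by
  have scaled : Integrable (fun u => gammaProdKernel a b (z / l ^ 2 * (u ^ 2 / 4)))
      ((gammaMeasure k l).map fun u => l * u) := by
    rw [map_mul_left_gammaMeasure k hl]
    exact (hasMellinBarnes_gammaProdKernel hb ha hb).integrable_comp_mul (by fun_prop)
      (ae_sq_div_four_pos_gammaMeasure k one_pos)
      (integrable_sq_div_four_rpow_gammaMeasure hk (by simpa using hk)) (by positivity)
  refine (scaled.comp_measurable (by fun_prop)).congr (ae_of_all _ fun u => ?_)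
  simp only [Function.comp_apply]
  congr 1
  field_simp

theorem dilationAverage_gammaMeasure_gammaProdKernel (a b k : ℝ) {l : ℝ} (hl : 0 < l) (z : ℝ) :
    dilationAverage (gammaMeasure k l) (fun u => u ^ 2 / 4) (gammaProdKernel a b) z =
      gammaRatioKernel a b k (z / l ^ 2) := by
  rw [gammaRatioKernel, dilationAverage, dilationAverage, ← map_mul_left_gammaMeasure k hl,
    integral_map (by fun_prop) (Measurable.aestronglyMeasurable (by fun_prop))]
  congr 1 with u
  congr 1
  field_simp

end GammaRatio

section Cumulative

/-- The measure `dt / t` on `(0, 1]`, whose moment of order `s` is `1 / s`. -/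
def logUnitMeasure : Measure ℝ :=
  mulDensity (Set.indicator (Set.Ioc 0 1) fun _ => (1 : ℝ))

/-- The cumulative distribution function `z ↦ ∫ t in (0, z], k t / t` of the measure with density
`k` with respect to `dx / x`, written as an average of dilations of `k`. -/
def cumulative (k : ℝ → ℝ) : ℝ → ℝ :=
  dilationAverage logUnitMeasure id k

instance : SFinite logUnitMeasure := by unfold logUnitMeasure; infer_instance

theorem measurable_indicator_Ioc_one :
    Measurable (Set.indicator (Set.Ioc (0 : ℝ) 1) fun _ => (1 : ℝ)) :=
  measurable_const.indicator measurableSet_Ioc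

theorem indicator_Ioc_one_nonneg (x : ℝ) :
    0 ≤ Set.indicator (Set.Ioc (0 : ℝ) 1) (fun _ => (1 : ℝ)) x :=
  Set.indicator_nonneg (fun _ _ => zero_le_one) x

theorem ae_pos_logUnitMeasure : ∀ᵐ t ∂logUnitMeasure, 0 < t := ae_pos_mulDensity _

theorem hasMellin_ofReal_indicator_Ioc_one {s : ℂ} (hs : 0 < s.re) :
    HasMellin (fun t => ((Set.indicator (Set.Ioc 0 1) (fun _ => 1) t : ℝ) : ℂ)) s (1 / s) := by
  have : (fun t => ((Set.indicator (Set.Ioc (0 : ℝ) 1) (fun _ => 1) t : ℝ) : ℂ)) =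
      Set.indicator (Set.Ioc 0 1) fun _ => 1 := by
    ext t
    by_cases ht : t ∈ Set.Ioc (0 : ℝ) 1 <;> simp [ht]
  rw [this]
  exact hasMellin_one_Ioc hs

theorem integrable_rpow_logUnitMeasure {c : ℝ} (hc : 0 < c) :
    Integrable (fun t => t ^ c) logUnitMeasure :=
  integrable_rpow_mulDensity measurable_indicator_Ioc_one (fun x _ => indicator_Ioc_one_nonneg x)
    (hasMellin_ofReal_indicator_Ioc_one (by simpa using hc)).1

theorem integral_cpow_logUnitMeasure {s : ℂ} (hs : 0 < s.re) :
    ∫ t, (t : ℂ) ^ s ∂logUnitMeasure = 1 / s := by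
  rw [logUnitMeasure, integral_cpow_mulDensity measurable_indicator_Ioc_one
    fun x _ => indicator_Ioc_one_nonneg x]
  exact (hasMellin_ofReal_indicator_Ioc_one hs).2

variable {c : ℝ} {k : ℝ → ℝ} {G : ℂ → ℂ}

theorem HasMellinBarnes.cumulative (h : HasMellinBarnes c k G) (hc : 0 < c) :
    HasMellinBarnes c (cumulative k) fun s => G s * (1 / s) :=
  (hasMellinBarnes_dilationAverage h measurable_id ae_pos_logUnitMeasure
    (integrable_rpow_logUnitMeasure hc)).congr fun s hs => by
      simp only [id_eq, integral_cpow_logUnitMeasure (hs ▸ hc)]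

theorem HasMellinBarnes.integrable_cumulative (h : HasMellinBarnes c k G) (hc : 0 < c) {z : ℝ}
    (hz : 0 < z) : Integrable (fun t => k (z * t)) logUnitMeasure :=
  h.integrable_comp_mul measurable_id ae_pos_logUnitMeasure (integrable_rpow_logUnitMeasure hc) hz

theorem cumulative_nonneg (hk0 : ∀ x, 0 < x → 0 ≤ k x) {z : ℝ} (hz : 0 < z) :
    0 ≤ cumulative k z :=
  dilationAverage_nonneg ae_pos_logUnitMeasure hk0 hz

theorem mulDensity_Iic (hk : Measurable k) (hk0 : ∀ x, 0 < x → 0 ≤ k x) {z : ℝ} (hz : 0 < z)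
    (hint : Integrable (fun t => k (z * t)) logUnitMeasure) :
    mulDensity k (Set.Iic z) = ENNReal.ofReal (cumulative k z) := by
  have dilate : mulDensity k (Set.Iic z) = mulDensity (fun t => k (z * t)) (Set.Iic 1) := by
    rw [← map_mul_left_mulDensity k hz, Measure.map_apply (by fun_prop) measurableSet_Iic]
    congr 1 with t
    simp [mul_le_iff_le_one_right hz]
  have truncate : ∀ t ∈ Set.Ioi (0 : ℝ),
      (Set.Iic 1).indicator (fun t => ENNReal.ofReal (t⁻¹ * k (z * t))) t =
        ENNReal.ofReal (t⁻¹ * (k (z * t) * Set.indicator (Set.Ioc 0 1) (fun _ => (1 : ℝ)) t)) := by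
    intro t (ht : 0 < t)
    by_cases h1 : t ≤ 1 <;> simp [ht, h1]
  rw [dilate, mulDensity_apply _ measurableSet_Iic, ← setLIntegral_indicator measurableSet_Iic,
    setLIntegral_congr_fun measurableSet_Ioi truncate, ← Set.univ_inter (Set.Ioi (0 : ℝ)),
    ← mulDensity_apply _ MeasurableSet.univ,
    ← mulDensity_mul_withDensity measurable_indicator_Ioc_one (by fun_prop)
      fun x _ => indicator_Ioc_one_nonneg x,
    withDensity_apply _ MeasurableSet.univ, Measure.restrict_univ, cumulative, dilationAverage]
  simp only [id_eq]
  rw [ofReal_integral_eq_lintegral_ofReal hint]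
  · rfl
  · filter_upwards [ae_pos_logUnitMeasure] with t ht using hk0 _ (mul_pos hz ht)

theorem cdf_mulDensity_of_nonpos (k : ℝ → ℝ) [IsProbabilityMeasure (mulDensity k)] {x : ℝ}
    (hx : x ≤ 0) : cdf (mulDensity k) x = 0 := by
  rw [cdf_eq_real, measureReal_eq_zero_iff]
  exact measure_mono_null (fun y (hy : y ≤ x) => not_lt.2 (hy.trans hx)) (ae_pos_mulDensity k)

theorem cdf_mulDensity [IsProbabilityMeasure (mulDensity k)] (hk : Measurable k)
    (hk0 : ∀ x, 0 < x → 0 ≤ k x) {z : ℝ} (hz : 0 < z)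
    (hint : Integrable (fun t => k (z * t)) logUnitMeasure) :
    cdf (mulDensity k) z = cumulative k z := by
  rw [cdf_eq_real, measureReal_def, mulDensity_Iic hk hk0 hz hint,
    ENNReal.toReal_ofReal (cumulative_nonneg hk0 hz)]

variable {a b : ℝ}

theorem integrable_gammaRatioKernel_comp (ha : 0 < a) (hb : 0 < b) {k : ℝ} (hk : 0 < k) {z : ℝ}
    (hz : 0 < z) : Integrable (fun t => gammaRatioKernel a b k (z * t)) logUnitMeasure := by
  obtain ⟨c, hc, hsep⟩ := exists_meijerSeparates_gammaRatio ha hb hk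
  exact (hasMellinBarnes_gammaRatioKernel hb hk hsep).integrable_cumulative hc hz

theorem ofReal_cumulative_gammaRatioKernel (ha : 0 < a) (hb : 0 < b) {k : ℝ} (hk : 0 < k) {z : ℝ}
    (hz : 0 < z) :
    (cumulative (gammaRatioKernel a b k) z : ℂ) = gammaRatioConst a b k *
      meijerG 2 3 ![1, (((1 - k) / 2 : ℝ) : ℂ), (((2 - k) / 2 : ℝ) : ℂ)]
        ![(a : ℂ), (b : ℂ), 0] z := by
  obtain ⟨c, hc⟩ := exists_meijerSeparates_gammaRatio ha hb hk
  refine ofReal_eq_mul_meijerG ⟨c, meijerSeparates_two_three_iff.2 hc⟩ (fun c' hc' => ?_) hz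
  obtain ⟨hc0, hsep⟩ := meijerSeparates_two_three_iff.1 hc'
  refine ((hasMellinBarnes_gammaRatioKernel hb hk hsep).cumulative hc0).congr fun s hs => ?_
  rw [meijerIntegrand_two_three 1 (hs ▸ hc0), mul_assoc]

end Cumulative

section Selection

theorem iIndepFun_curry {Ω ι : Type*} {κ : ι → Type*} {E : (i : ι) → κ i → Type*}
    [MeasurableSpace Ω] [∀ i j, MeasurableSpace (E i j)] {μ : Measure Ω}
    {X : (i : ι) → (j : κ i) → Ω → E i j} (hm : ∀ i j, Measurable (X i j))
    (h : iIndepFun (fun (p : (i : ι) × κ i) ω => X p.1 p.2 ω) μ) :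
    iIndepFun (fun i ω j => X i j ω) μ := by
  have := h.isProbabilityMeasure
  have : ∀ i j, IsProbabilityMeasure (μ.map (X i j)) :=
    fun i j => Measure.isProbabilityMeasure_map (hm i j).aemeasurable
  have row : ∀ i, μ.map (fun ω j => X i j ω) = Measure.infinitePi fun j => μ.map (X i j) :=
    fun i => (h.precomp (g := Sigma.mk i) sigma_mk_injective).map_fun_eq_infinitePi_map (hm i)
  have curry : (fun ω i j => X i j ω) =
      MeasurableEquiv.piCurry E ∘ fun ω (p : (i : ι) × κ i) => X p.1 p.2 ω := rfl
  rw [iIndepFun_iff_map_fun_eq_infinitePi_map (by fun_prop), curry,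
    ← Measure.map_map (by fun_prop) (by fun_prop),
    h.map_fun_eq_infinitePi_map (fun p => hm p.1 p.2),
    Measure.infinitePi_map_piCurry fun i j => μ.map (X i j)]
  simp only [row]

theorem measurable_selected {Ω F ι : Type*} [MeasurableSpace Ω] [MeasurableSpace F]
    [MeasurableSpace ι] [Countable ι] [MeasurableSingletonClass ι] {X : ι → Ω → F}
    (hX : ∀ i, Measurable (X i)) {sel : Ω → ι} (hsel : Measurable sel) :
    Measurable fun ω => X (sel ω) ω :=
  (measurable_from_prod_countable_right (f := fun p : ι × Ω => X p.1 p.2) hX).comp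
    (hsel.prodMk measurable_id)

/-- The law of the smallest of `n` independent random variables whose common law `ν` has no
atoms. -/
def minLaw (n : ℕ) (ν : Measure ℝ) : Measure ℝ :=
  ν.withDensity fun u => n * ν (Set.Ioi u) ^ (n - 1)

instance (n : ℕ) (ν : Measure ℝ) [SFinite ν] : SFinite (minLaw n ν) := by
  unfold minLaw
  infer_instance

theorem minLaw_absolutelyContinuous (n : ℕ) (ν : Measure ℝ) : minLaw n ν ≪ ν :=
  withDensity_absolutelyContinuous _ _

theorem minLaw_le_smul (n : ℕ) (ν : Measure ℝ) [IsProbabilityMeasure ν] :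
    minLaw n ν ≤ (n : ENNReal) • ν := by
  rw [← withDensity_const]
  exact withDensity_mono (ae_of_all _ fun u => mul_le_of_le_one_right' (pow_le_one' prob_le_one _))

variable {Ω E ι : Type*} [MeasurableSpace Ω] [MeasurableSpace E] {μ : Measure Ω} [Fintype ι]
  {V : ι → Ω → E} {U : ι → Ω → ℝ} {P : Measure E} {ν : Measure ℝ}

theorem hasLaw_pair_others [DecidableEq ι] [IsProbabilityMeasure P] [IsProbabilityMeasure ν]
    (hind : iIndepFun (fun i ω => (V i ω, U i ω)) μ)
    (hV : ∀ i, Measurable (V i)) (hU : ∀ i, Measurable (U i))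
    (hlaw : ∀ i, HasLaw (fun ω => (V i ω, U i ω)) (P.prod ν) μ) (i : ι) :
    HasLaw (fun ω => ((V i ω, U i ω), fun j : {j // j ≠ i} => U j ω))
      ((P.prod ν).prod (Measure.pi fun _ => ν)) μ := by
  have := hind.isProbabilityMeasure
  have snd_law : HasLaw Prod.snd ν (P.prod ν) :=
    ⟨measurable_snd.aemeasurable, by rw [Measure.map_snd_prod, measure_univ, one_smul]⟩
  have others : HasLaw (fun ω (j : {j // j ≠ i}) => U j ω) (Measure.pi fun _ => ν) μ :=
    ((hind.comp (fun _ => Prod.snd) fun _ => measurable_snd).precomp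
      Subtype.val_injective).hasLaw_pi fun j => snd_law.comp (hlaw j)
  refine IndepFun.hasLaw_prod (hlaw i) others ?_
  have blocks := hind.indepFun_finset {i} (Finset.univ.erase i) (by simp)
    fun j => (hV j).prodMk (hU j)
  have self : Measurable fun v : ({i} : Finset ι) → E × ℝ => v ⟨i, by simp⟩ := by fun_prop
  have rest : Measurable fun (v : Finset.univ.erase i → E × ℝ) (j : {j // j ≠ i}) =>
      (v ⟨j, by simp [j.2]⟩).2 := by fun_prop
  exact blocks.comp self rest

theorem measure_mem_inter_forall_ne [IsProbabilityMeasure P] [IsProbabilityMeasure ν]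
    (hind : iIndepFun (fun i ω => (V i ω, U i ω)) μ)
    (hV : ∀ i, Measurable (V i)) (hU : ∀ i, Measurable (U i))
    (hlaw : ∀ i, HasLaw (fun ω => (V i ω, U i ω)) (P.prod ν) μ) {C : ℝ → Set ℝ}
    (hC : MeasurableSet {p : ℝ × ℝ | p.2 ∈ C p.1}) {B : Set (E × ℝ)} (hB : MeasurableSet B)
    (i : ι) :
    μ {ω | (V i ω, U i ω) ∈ B ∧ ∀ j, j ≠ i → U j ω ∈ C (U i ω)} =
      ∫⁻ p in B, ν (C p.2) ^ (Fintype.card ι - 1) ∂(P.prod ν) := by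
  classical
  let A : Set ((E × ℝ) × ({j // j ≠ i} → ℝ)) :=
    Prod.fst ⁻¹' B ∩ ⋂ j, (fun p => (p.1.2, p.2 j)) ⁻¹' {q : ℝ × ℝ | q.2 ∈ C q.1}
  have hA : MeasurableSet A := (measurable_fst hB).inter <| .iInter fun j =>
    (by fun_prop : Measurable fun p : (E × ℝ) × ({j // j ≠ i} → ℝ) => (p.1.2, p.2 j)) hC
  have slice : ∀ p : E × ℝ, (Measure.pi fun _ : {j // j ≠ i} => ν) (Prod.mk p ⁻¹' A) =
      B.indicator (fun p => ν (C p.2) ^ (Fintype.card ι - 1)) p := by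
    intro p
    by_cases hp : p ∈ B
    · have : Prod.mk p ⁻¹' A = Set.univ.pi fun _ => C p.2 := by
        ext v
        simp [A, hp]
      rw [this, Measure.pi_pi, Finset.prod_const, Finset.card_univ, Set.indicator_of_mem hp,
        Fintype.card_subtype_compl, Fintype.card_subtype_eq]
    · have : Prod.mk p ⁻¹' A = ∅ := by
        ext v
        simp [A, hp]
      rw [this, measure_empty, Set.indicator_of_notMem hp]
  have event : {ω | (V i ω, U i ω) ∈ B ∧ ∀ j, j ≠ i → U j ω ∈ C (U i ω)} =
      (fun ω => ((V i ω, U i ω), fun j : {j // j ≠ i} => U j ω)) ⁻¹' A := by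
    ext ω
    simp [A]
  rw [event, ← Measure.map_apply (by fun_prop) hA,
    (hasLaw_pair_others hind hV hU hlaw i).map_eq, Measure.prod_apply hA,
    lintegral_congr slice, lintegral_indicator hB]

theorem measure_selected_eq [IsProbabilityMeasure P] [IsProbabilityMeasure ν]
    [NullSingletonClass ν] (hind : iIndepFun (fun i ω => (V i ω, U i ω)) μ)
    (hV : ∀ i, Measurable (V i)) (hU : ∀ i, Measurable (U i))
    (hlaw : ∀ i, HasLaw (fun ω => (V i ω, U i ω)) (P.prod ν) μ) {sel : Ω → ι}
    (hmin : ∀ᵐ ω ∂μ, ∀ j, U (sel ω) ω ≤ U j ω) {B : Set (E × ℝ)} (hB : MeasurableSet B) (i : ι) :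
    μ {ω | sel ω = i ∧ (V i ω, U i ω) ∈ B} =
      ∫⁻ p in B, ν (Set.Ioi p.2) ^ (Fintype.card ι - 1) ∂(P.prod ν) := by
  have strict := measure_mem_inter_forall_ne hind hV hU hlaw (C := Set.Ioi)
    (measurableSet_lt measurable_fst measurable_snd) hB i
  have weak := measure_mem_inter_forall_ne hind hV hU hlaw (C := Set.Ici)
    (measurableSet_le measurable_fst measurable_snd) hB i
  simp only [← measure_congr (Ioi_ae_eq_Ici (μ := ν))] at weak
  refine le_antisymm (weak ▸ measure_mono_ae ?_) (strict ▸ measure_mono_ae ?_)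
  · filter_upwards [hmin] with ω hω ⟨hsel, hb⟩
    exact ⟨hb, fun j _ => hsel ▸ hω j⟩
  · filter_upwards [hmin] with ω hω ⟨hb, hlt⟩
    exact ⟨by_contra fun hne => (hω i).not_gt (hlt _ hne), hb⟩

/-- Since ties have probability zero, `{sel = i}` is up to null sets the event that `U i` lies
strictly below the other `U j`, and these are independent of the pair `(V i, U i)`. -/
theorem hasLaw_selected [MeasurableSpace ι] [MeasurableSingletonClass ι]
    [IsProbabilityMeasure P] [IsProbabilityMeasure ν] [NullSingletonClass ν]
    (hind : iIndepFun (fun i ω => (V i ω, U i ω)) μ)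
    (hV : ∀ i, Measurable (V i)) (hU : ∀ i, Measurable (U i))
    (hlaw : ∀ i, HasLaw (fun ω => (V i ω, U i ω)) (P.prod ν) μ) {sel : Ω → ι}
    (hsel : Measurable sel) (hmin : ∀ᵐ ω ∂μ, ∀ j, U (sel ω) ω ≤ U j ω) :
    HasLaw (fun ω => (V (sel ω) ω, U (sel ω) ω)) (P.prod (minLaw (Fintype.card ι) ν)) μ := by
  have hmeas : Measurable fun ω => (V (sel ω) ω, U (sel ω) ω) :=
    measurable_selected (fun i => (hV i).prodMk (hU i)) hsel
  have htail : Measurable fun u => ν (Set.Ioi u) :=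
    Antitone.measurable fun _ _ h => measure_mono (Set.Ioi_subset_Ioi h)
  refine ⟨hmeas.aemeasurable, Measure.ext fun B hB => ?_⟩
  have fiber : ∀ i, {ω | sel ω = i ∧ (V i ω, U i ω) ∈ B} =
      sel ⁻¹' {i} ∩ (fun ω => (V i ω, U i ω)) ⁻¹' B := fun i => rfl
  have cover : (fun ω => (V (sel ω) ω, U (sel ω) ω)) ⁻¹' B =
      ⋃ i, {ω | sel ω = i ∧ (V i ω, U i ω) ∈ B} := by
    ext ω
    simp
  rw [Measure.map_apply hmeas hB, cover, measure_iUnion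
      (fun i j hij => Set.disjoint_left.2 fun ω hi hj => hij (hi.1.symm.trans hj.1))
      fun i => fiber i ▸ (hsel (measurableSet_singleton i)).inter ((hV i).prodMk (hU i) hB),
    tsum_fintype, Finset.sum_congr rfl fun i _ => measure_selected_eq hind hV hU hlaw hmin hB i,
    Finset.sum_const, Finset.card_univ, nsmul_eq_mul, minLaw,
    prod_withDensity_right ((htail.pow_const _).const_mul _), withDensity_apply _ hB,
    lintegral_const_mul' _ _ (ENNReal.natCast_ne_top _)]

end Selection

section ErlangTail

/-- The tail probability `P(U > u)` of an Erlang variable of integer shape `K` and rate `1`, which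
is a polynomial times an exponential. -/
def erlangTail (K : ℕ) (u : ℝ) : ℝ :=
  Real.exp (-u) * ∑ j : Fin K, u ^ (j : ℕ) / ((j : ℕ).factorial : ℝ)

@[fun_prop]
theorem measurable_erlangTail (K : ℕ) : Measurable (erlangTail K) := by
  unfold erlangTail
  fun_prop

theorem erlangTail_nonneg (K : ℕ) {u : ℝ} (hu : 0 ≤ u) : 0 ≤ erlangTail K u :=
  mul_nonneg (Real.exp_pos _).le (Finset.sum_nonneg fun j _ => by positivity)

theorem hasDerivAt_sum_pow_div_factorial (K : ℕ) (u : ℝ) :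
    HasDerivAt (fun u : ℝ => ∑ j ∈ Finset.range (K + 1), u ^ j / (j.factorial : ℝ))
      (∑ j ∈ Finset.range K, u ^ j / (j.factorial : ℝ)) u := by
  refine (HasDerivAt.fun_sum (u := Finset.range (K + 1)) fun j _ =>
    (hasDerivAt_pow j u).div_const (j.factorial : ℝ)).congr_deriv ?_
  rw [Finset.sum_range_succ']
  simp only [Nat.cast_zero, zero_mul, zero_div, add_zero]
  refine Finset.sum_congr rfl fun j _ => ?_
  rw [Nat.factorial_succ, Nat.add_sub_cancel, Nat.cast_mul,
    mul_div_mul_left _ _ (by positivity : ((j + 1 : ℕ) : ℝ) ≠ 0)]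

theorem hasDerivAt_neg_erlangTail_succ (K : ℕ) (u : ℝ) :
    HasDerivAt (fun u => -erlangTail (K + 1) u) (Real.exp (-u) * (u ^ K / (K.factorial : ℝ)))
      u := by
  have tail_eq : (fun u => -erlangTail (K + 1) u) = fun u =>
      -(Real.exp (-u) * ∑ j ∈ Finset.range (K + 1), u ^ j / (j.factorial : ℝ)) := by
    ext v
    rw [erlangTail, Fin.sum_univ_eq_sum_range fun j => v ^ j / (j.factorial : ℝ)]
  rw [tail_eq]
  refine ((hasDerivAt_neg u).exp.mul (hasDerivAt_sum_pow_div_factorial K u)).fun_neg.congr_deriv ?_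
  rw [Finset.sum_range_succ]
  ring

theorem tendsto_erlangTail_atTop (K : ℕ) :
    Filter.Tendsto (erlangTail K) Filter.atTop (nhds 0) := by
  have h : Filter.Tendsto (fun u : ℝ => ∑ j : Fin K,
      u ^ (j : ℕ) * Real.exp (-u) / ((j : ℕ).factorial : ℝ)) Filter.atTop
      (nhds (∑ j : Fin K, 0 / ((j : ℕ).factorial : ℝ))) :=
    tendsto_finsetSum _ fun j _ => (Real.tendsto_pow_mul_exp_neg_atTop_nhds_zero j).div_const _
  simp only [zero_div, Finset.sum_const_zero] at h
  refine h.congr fun u => ?_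
  rw [erlangTail, Finset.mul_sum]
  exact Finset.sum_congr rfl fun j _ => by ring

theorem gammaMeasure_Ioi {K : ℕ} (hK : 0 < K) {u : ℝ} (hu : 0 ≤ u) :
    gammaMeasure K 1 (Set.Ioi u) = ENNReal.ofReal (erlangTail K u) := by
  obtain ⟨n, rfl⟩ := Nat.exists_eq_add_one_of_ne_zero hK.ne'
  have hlim : Filter.Tendsto (fun u => -erlangTail (n + 1) u) Filter.atTop (nhds 0) := by
    simpa using (tendsto_erlangTail_atTop (n + 1)).neg
  have hnonneg : ∀ x ∈ Set.Ioi u, 0 ≤ Real.exp (-x) * (x ^ n / (n.factorial : ℝ)) :=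
    fun x hx => by
      have : 0 ≤ x := hu.trans (le_of_lt hx)
      positivity
  have hderiv := fun x (_ : x ∈ Set.Ici u) => hasDerivAt_neg_erlangTail_succ n x
  have integral_eq := integral_Ioi_of_hasDerivAt_of_nonneg' hderiv hnonneg hlim
  rw [zero_sub, neg_neg] at integral_eq
  rw [gammaMeasure, withDensity_apply _ measurableSet_Ioi, ← integral_eq,
    ofReal_integral_eq_lintegral_ofReal (integrableOn_Ioi_deriv_of_nonneg' hderiv hnonneg hlim)
      ((ae_restrict_mem measurableSet_Ioi).mono hnonneg)]
  refine setLIntegral_congr_fun measurableSet_Ioi fun x hx => ?_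
  rw [gammaPDF_of_nonneg (hu.trans (le_of_lt hx))]
  push_cast
  rw [Real.Gamma_nat_eq_factorial, Real.one_rpow, add_sub_cancel_right, Real.rpow_natCast, one_mul]
  ring_nf

theorem erlangTail_pow (K i : ℕ) (u : ℝ) :
    erlangTail K u ^ i = ∑ n ∈ Finset.piAntidiag (Finset.univ : Finset (Fin K)) i,
      (i.factorial : ℝ) / (∏ j : Fin K, ((n j).factorial : ℝ)) *
        (∏ j : Fin K, (1 / ((j : ℕ).factorial : ℝ)) ^ n j) *
        (u ^ (∑ j : Fin K, (j : ℕ) * n j) * Real.exp (-(i * u))) := by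
  rw [erlangTail, mul_pow, Finset.sum_pow_eq_sum_piAntidiag, Finset.mul_sum]
  refine Finset.sum_congr rfl fun n hn => ?_
  have multinomial_eq : (Nat.multinomial Finset.univ n : ℝ) =
      (i.factorial : ℝ) / (∏ j : Fin K, ((n j).factorial : ℝ)) := by
    have h0 : (∏ j : Fin K, ((n j).factorial : ℝ)) ≠ 0 :=
      Finset.prod_ne_zero_iff.2 fun j _ => by positivity
    rw [eq_div_iff h0, ← (Finset.mem_piAntidiag.1 hn).1, ← Nat.multinomial_spec Finset.univ n]
    push_cast
    ring
  have monomial_eq : ∏ j : Fin K, (u ^ (j : ℕ) / ((j : ℕ).factorial : ℝ)) ^ n j =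
      (∏ j : Fin K, (1 / ((j : ℕ).factorial : ℝ)) ^ n j) * u ^ (∑ j : Fin K, (j : ℕ) * n j) := by
    rw [← Finset.prod_pow_eq_pow_sum, ← Finset.prod_mul_distrib]
    refine Finset.prod_congr rfl fun j _ => ?_
    rw [pow_mul, ← mul_pow]
    ring
  rw [multinomial_eq, monomial_eq, ← Real.exp_nat_mul]
  ring_nf

/-- Expanding `Q ^ M = ((Q - 1) + 1) ^ M` twice. -/
theorem pow_eq_sum_choose_mul_choose {R : Type*} [CommRing R] (Q : R) (M : ℕ) :
    Q ^ M = ∑ i₁ ∈ Finset.range (M + 1), ∑ i₂ ∈ Finset.range (i₁ + 1),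
      (M.choose i₁ : R) * (i₁.choose i₂ : R) * ((-1) ^ (i₁ + i₂) * Q ^ i₂) := by
  conv_lhs => rw [show Q = (Q + -1) + 1 by ring, add_pow]
  refine Finset.sum_congr rfl fun i₁ _ => ?_
  rw [one_pow, mul_one, add_pow, Finset.sum_mul]
  refine Finset.sum_congr rfl fun i₂ hi => ?_
  have sign_eq : (-1 : R) ^ (i₁ + i₂) = (-1) ^ (i₁ - i₂) := by
    have hle : i₂ ≤ i₁ := Nat.lt_succ_iff.1 (Finset.mem_range.1 hi)
    rw [show i₁ + i₂ = (i₁ - i₂) + 2 * i₂ by omega, pow_add, pow_mul, neg_one_sq, one_pow, mul_one]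
  rw [sign_eq]
  ring

end ErlangTail

section ErlangMin

/-- The density, with respect to `du / u`, of the smallest of `L` independent Erlang variables of
shape `K` and rate `1`. -/
def erlangMinKernel (L K : ℕ) (u : ℝ) : ℝ :=
  L * erlangTail K u ^ (L - 1) * gammaKernel K u

@[fun_prop]
theorem measurable_erlangMinKernel (L K : ℕ) : Measurable (erlangMinKernel L K) := by
  unfold erlangMinKernel
  fun_prop

theorem erlangMinKernel_nonneg (L : ℕ) {K : ℕ} (hK : 0 < K) {u : ℝ} (hu : 0 < u) :
    0 ≤ erlangMinKernel L K u :=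
  mul_nonneg (mul_nonneg L.cast_nonneg (pow_nonneg (erlangTail_nonneg K hu.le) _))
    (gammaKernel_nonneg (by positivity) hu)

theorem minLaw_gammaMeasure (L : ℕ) {K : ℕ} (hK : 0 < K) :
    minLaw L (gammaMeasure K 1) = mulDensity (erlangMinKernel L K) := by
  have tail_eq : (fun u => (L : ENNReal) * gammaMeasure K 1 (Set.Ioi u) ^ (L - 1))
      =ᵐ[gammaMeasure K 1] fun u => ENNReal.ofReal (L * erlangTail K u ^ (L - 1)) := by
    filter_upwards [ae_pos_gammaMeasure K one_pos] with u hu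
    rw [gammaMeasure_Ioi hK hu.le, ENNReal.ofReal_mul L.cast_nonneg, ENNReal.ofReal_natCast,
      ENNReal.ofReal_pow (erlangTail_nonneg K hu.le)]
  rw [minLaw, withDensity_congr_ae tail_eq, gammaMeasure_one_eq_mulDensity,
    mulDensity_mul_withDensity (by fun_prop) (by fun_prop)
      fun x => gammaKernel_nonneg (by positivity)]
  rfl

/-- The indices `(i₁, i₂, n)` of the gamma laws whose signed mixture is the law of the smallest of
`L` independent Erlang variables of shape `K`. -/
def erlangMinIndex (L K : ℕ) : Finset (Σ _ : ℕ, Σ _ : ℕ, Fin K → ℕ) :=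
  (Finset.range L).sigma fun i₁ => (Finset.range (i₁ + 1)).sigma fun i₂ =>
    Finset.piAntidiag Finset.univ i₂

/-- The shape of the gamma law of index `(i₁, i₂, n)` in the mixture; its rate is `i₂ + 1`. -/
def erlangMinShape {K : ℕ} (n : Fin K → ℕ) : ℝ :=
  K + ((∑ j : Fin K, (j : ℕ) * n j : ℕ) : ℝ)

/-- The signed weight of the gamma law of index `(i₁, i₂, n)` in the mixture. -/
def erlangMinWeight (L : ℕ) {K : ℕ} (i₁ i₂ : ℕ) (n : Fin K → ℕ) : ℝ :=
  ((L - 1).choose i₁ : ℝ) * (i₁.choose i₂ : ℝ) * (-1) ^ (i₁ + i₂) *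
    ((i₂.factorial : ℝ) / (∏ j : Fin K, ((n j).factorial : ℝ)) *
      ∏ j : Fin K, (1 / ((j : ℕ).factorial : ℝ)) ^ n j) *
    (L / Real.Gamma K *
      (Real.Gamma (erlangMinShape n) / ((i₂ : ℝ) + 1) ^ erlangMinShape n))

theorem erlangMinShape_pos {K : ℕ} (hK : 0 < K) (n : Fin K → ℕ) : 0 < erlangMinShape n := by
  unfold erlangMinShape
  positivity

theorem sum_erlangMinIndex {M : Type*} [AddCommMonoid M] (L K : ℕ)
    (T : ℕ → ℕ → (Fin K → ℕ) → M) :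
    ∑ p ∈ erlangMinIndex L K, T p.1 p.2.1 p.2.2 =
      ∑ i₁ ∈ Finset.range L, ∑ i₂ ∈ Finset.range (i₁ + 1),
        ∑ n ∈ Finset.piAntidiag (Finset.univ : Finset (Fin K)) i₂, T i₁ i₂ n := by
  simp only [erlangMinIndex, Finset.sum_sigma]

theorem gammaKernel_erlangMinShape {K : ℕ} (hK : 0 < K) (i₂ : ℕ) (n : Fin K → ℕ) {u : ℝ}
    (hu : 0 < u) :
    Real.Gamma (erlangMinShape n) / ((i₂ : ℝ) + 1) ^ erlangMinShape n *
        gammaKernel (erlangMinShape n) (((i₂ : ℝ) + 1) * u) =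
      u ^ (∑ j : Fin K, (j : ℕ) * n j) * Real.exp (-(i₂ * u)) *
        (u ^ (K : ℝ) * Real.exp (-u)) := by
  have hG := (Real.Gamma_pos_of_pos (erlangMinShape_pos hK n)).ne'
  have hl : ((i₂ : ℝ) + 1) ^ erlangMinShape n ≠ 0 := by positivity
  have hexp : Real.exp (-(((i₂ : ℝ) + 1) * u)) = Real.exp (-(i₂ * u)) * Real.exp (-u) := by
    rw [← Real.exp_add]
    ring_nf
  rw [gammaKernel, Real.mul_rpow (by positivity) hu.le, hexp]
  field_simp
  rw [erlangMinShape, Real.rpow_add hu, Real.rpow_natCast u (∑ j, _)]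
  ring

theorem erlangMinKernel_eq_sum {L K : ℕ} (hL : 1 ≤ L) (hK : 0 < K) {u : ℝ} (hu : 0 < u) :
    erlangMinKernel L K u = ∑ p ∈ erlangMinIndex L K, erlangMinWeight L p.1 p.2.1 p.2.2 *
      gammaKernel (erlangMinShape p.2.2) (((p.2.1 : ℝ) + 1) * u) := by
  rw [sum_erlangMinIndex L K fun i₁ i₂ n => erlangMinWeight L i₁ i₂ n *
      gammaKernel (erlangMinShape n) (((i₂ : ℝ) + 1) * u), erlangMinKernel,
    pow_eq_sum_choose_mul_choose, Nat.sub_add_cancel hL, Finset.mul_sum, Finset.sum_mul]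
  refine Finset.sum_congr rfl fun i₁ _ => ?_
  rw [Finset.mul_sum, Finset.sum_mul]
  refine Finset.sum_congr rfl fun i₂ _ => ?_
  rw [erlangTail_pow]
  simp only [Finset.mul_sum, Finset.sum_mul]
  refine Finset.sum_congr rfl fun n _ => ?_
  rw [erlangMinWeight, mul_assoc (_ * _ * _ * _), mul_assoc (_ / Real.Gamma K),
    gammaKernel_erlangMinShape hK i₂ n hu, gammaKernel]
  ring

theorem integral_minLaw_gammaMeasure {E : Type*} [NormedAddCommGroup E] [NormedSpace ℝ E]
    {L K : ℕ} (hL : 1 ≤ L) (hK : 0 < K) {f : ℝ → E}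
    (hf : ∀ k l : ℝ, 0 < k → 0 < l → Integrable f (gammaMeasure k l)) :
    ∫ u, f u ∂(minLaw L (gammaMeasure K 1)) =
      ∑ p ∈ erlangMinIndex L K, erlangMinWeight L p.1 p.2.1 p.2.2 •
        ∫ u, f u ∂(gammaMeasure (erlangMinShape p.2.2) ((p.2.1 : ℝ) + 1)) := by
  have rate_pos : ∀ i : ℕ, 0 < (i : ℝ) + 1 := fun i => by positivity
  rw [minLaw_gammaMeasure L hK, integral_mulDensity_sum (fun p _ => by fun_prop)
    (fun p _ x hx => gammaKernel_nonneg (erlangMinShape_pos hK p.2.2)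
      (mul_pos (rate_pos p.2.1) hx))
    (by fun_prop) (fun u => erlangMinKernel_nonneg L hK) (fun u => erlangMinKernel_eq_sum hL hK)
    fun p _ => ?_]
  · simp only [gammaMeasure_eq_mulDensity _ (rate_pos _)]
  · rw [← gammaMeasure_eq_mulDensity _ (rate_pos p.2.1)]
    exact hf _ _ (erlangMinShape_pos hK p.2.2) (rate_pos p.2.1)

end ErlangMin

section SNRKernel

/-- The density, with respect to `dx / x`, of the output SNR divided by its scale: that of
`V / (U ^ 2 / 4)`, where `V` is the product of two gamma variables of shapes `a` and `b` and `U` is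
the smallest of `L` Erlang variables of shape `K`. -/
def snrKernel (a b : ℝ) (L K : ℕ) : ℝ → ℝ :=
  dilationAverage (minLaw L (gammaMeasure K 1)) (fun u => u ^ 2 / 4) (gammaProdKernel a b)

@[fun_prop]
theorem measurable_snrKernel (a b : ℝ) (L K : ℕ) : Measurable (snrKernel a b L K) :=
  measurable_dilationAverage (by fun_prop) (by fun_prop)

variable {a b : ℝ} {L K : ℕ}

theorem ae_sq_div_four_pos_minLaw (L K : ℕ) :
    ∀ᵐ u ∂(minLaw L (gammaMeasure K 1)), 0 < u ^ 2 / 4 :=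
  (minLaw_absolutelyContinuous L _).ae_le (ae_sq_div_four_pos_gammaMeasure K one_pos)

theorem snrKernel_nonneg (b : ℝ) (L K : ℕ) (ha : 0 < a) {z : ℝ} (hz : 0 < z) :
    0 ≤ snrKernel a b L K z :=
  dilationAverage_nonneg (ae_sq_div_four_pos_minLaw L K)
    (fun _ => gammaProdKernel_nonneg b ha) hz

theorem map_div_sq_mconv_prod_minLaw (ha : 0 < a) (hb : 0 < b) (L : ℕ) (hK : 0 < K) :
    ((gammaMeasure a 1 ∗ₘ gammaMeasure b 1).prod (minLaw L (gammaMeasure K 1))).map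
      (fun q => q.1 / (q.2 ^ 2 / 4)) = mulDensity (snrKernel a b L K) := by
  have hK' : (0 : ℝ) < K := Nat.cast_pos.2 hK
  have := isProbabilityMeasure_gammaMeasure hK' one_pos
  rw [mconv_gammaMeasure ha hb]
  exact map_div_mulDensity_prod (by fun_prop) (fun _ => gammaProdKernel_nonneg b ha)
    (p := fun u => u ^ 2 / 4) (by fun_prop) (ae_sq_div_four_pos_minLaw L K) fun z hz =>
    ((integrable_gammaProdKernel_comp ha hb hK' one_pos hz).smul_measure
      (ENNReal.natCast_ne_top L)).mono_measure (minLaw_le_smul L _)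

theorem snrKernel_eq_sum (ha : 0 < a) (hb : 0 < b) (hL : 1 ≤ L) (hK : 0 < K) {z : ℝ} (hz : 0 < z) :
    snrKernel a b L K z = ∑ p ∈ erlangMinIndex L K, erlangMinWeight L p.1 p.2.1 p.2.2 *
      gammaRatioKernel a b (erlangMinShape p.2.2) (z / ((p.2.1 : ℝ) + 1) ^ 2) := by
  rw [snrKernel, dilationAverage, integral_minLaw_gammaMeasure hL hK fun k l hk hl =>
    integrable_gammaProdKernel_comp ha hb hk hl hz]
  refine Finset.sum_congr rfl fun p _ => ?_
  rw [smul_eq_mul, ← dilationAverage_gammaMeasure_gammaProdKernel a b _ (by positivity)]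
  rfl

theorem integrable_snrKernel_term_comp (ha : 0 < a) (hb : 0 < b) (hK : 0 < K) (i : ℕ)
    (n : Fin K → ℕ) {z : ℝ} (hz : 0 < z) :
    Integrable (fun t => gammaRatioKernel a b (erlangMinShape n) (z * t / ((i : ℝ) + 1) ^ 2))
      logUnitMeasure := by
  simp only [mul_div_right_comm]
  exact integrable_gammaRatioKernel_comp ha hb (erlangMinShape_pos hK n) (by positivity)

theorem snrKernel_comp_ae_eq_sum (ha : 0 < a) (hb : 0 < b) (hL : 1 ≤ L) (hK : 0 < K) {z : ℝ}
    (hz : 0 < z) :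
    (fun t => snrKernel a b L K (z * t)) =ᵐ[logUnitMeasure] fun t =>
      ∑ p ∈ erlangMinIndex L K, erlangMinWeight L p.1 p.2.1 p.2.2 *
        gammaRatioKernel a b (erlangMinShape p.2.2) (z * t / ((p.2.1 : ℝ) + 1) ^ 2) :=
  ae_pos_logUnitMeasure.mono fun _ ht => snrKernel_eq_sum ha hb hL hK (mul_pos hz ht)

theorem integrable_snrKernel_comp (ha : 0 < a) (hb : 0 < b) (hL : 1 ≤ L) (hK : 0 < K) {z : ℝ}
    (hz : 0 < z) : Integrable (fun t => snrKernel a b L K (z * t)) logUnitMeasure :=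
  (integrable_finsetSum _ fun p _ => (integrable_snrKernel_term_comp ha hb hK p.2.1 p.2.2
    hz).const_mul _).congr (snrKernel_comp_ae_eq_sum ha hb hL hK hz).symm

theorem cumulative_snrKernel_eq_sum (ha : 0 < a) (hb : 0 < b) (hL : 1 ≤ L) (hK : 0 < K) {z : ℝ}
    (hz : 0 < z) :
    cumulative (snrKernel a b L K) z =
      ∑ p ∈ erlangMinIndex L K, erlangMinWeight L p.1 p.2.1 p.2.2 *
        cumulative (gammaRatioKernel a b (erlangMinShape p.2.2))
          (z / ((p.2.1 : ℝ) + 1) ^ 2) := by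
  simp only [cumulative, dilationAverage, id_eq]
  rw [integral_congr_ae (snrKernel_comp_ae_eq_sum ha hb hL hK hz), integral_finsetSum _ fun p _ =>
    (integrable_snrKernel_term_comp ha hb hK p.2.1 p.2.2 hz).const_mul _]
  simp only [integral_const_mul, mul_div_right_comm]

end SNRKernel

section ClosedForm

variable {L K : ℕ} {m α g : Fin 2 → ℝ} {msq : ℝ}

theorem snrScale_pos (hm : ∀ j, 0 < m j) (hg : ∀ j, 0 < g j) (hmsq : 0 < msq) :
    0 < snrScale m g msq :=
  div_pos (mul_pos (hm 0) (hm 1)) (mul_pos (pow_pos hmsq 2) (mul_pos (hg 0) (hg 1)))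

theorem snrExponent_eq (hK : 2 * α 0 = (K : ℝ)) (hα₂ : α 1 = α 0 + 1 / 2) (n : Fin K → ℕ) :
    snrExponent α n = erlangMinShape n + 1 / 2 := by
  rw [snrExponent, erlangMinShape, hα₂, ← hK]
  push_cast
  ring

theorem snrConst_eq (hK : 2 * α 0 = (K : ℝ)) (hα₂ : α 1 = α 0 + 1 / 2) (m : Fin 2 → ℝ) :
    snrConst m α = 2 ^ ((K : ℝ) - 1) /
      (√Real.pi * Real.Gamma (m 0) * Real.Gamma (m 1) * Real.Gamma K) := by
  have hΓ : Real.Gamma (α 0) * Real.Gamma (α 1) =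
      Real.Gamma K * (2 ^ ((K : ℝ) - 1))⁻¹ * √Real.pi := by
    rw [hα₂, Real.Gamma_mul_Gamma_add_half, hK, ← Real.rpow_neg zero_le_two, neg_sub]
  rw [snrConst, mul_assoc (_ * _), hΓ]
  field_simp

theorem prod_two_pow_div_factorial_pow (n : Fin K → ℕ) :
    ∏ j : Fin K, ((2 : ℝ) ^ (j : ℕ) / ((j : ℕ).factorial : ℝ)) ^ n j =
      2 ^ (∑ j : Fin K, (j : ℕ) * n j) * ∏ j : Fin K, (1 / ((j : ℕ).factorial : ℝ)) ^ n j := by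
  rw [← Finset.prod_pow_eq_pow_sum, ← Finset.prod_mul_distrib]
  refine Finset.prod_congr rfl fun j _ => ?_
  rw [pow_mul, ← mul_pow]
  ring

theorem erlangMinWeight_mul_gammaRatioConst (hK0 : 0 < K) (hK : 2 * α 0 = (K : ℝ))
    (hα₂ : α 1 = α 0 + 1 / 2) (L : ℕ) (m : Fin 2 → ℝ) (i₁ i₂ : ℕ) (n : Fin K → ℕ) :
    erlangMinWeight L i₁ i₂ n * gammaRatioConst (m 0) (m 1) (erlangMinShape n) =
      ((L - 1).choose i₁ : ℝ) * (i₁.choose i₂ : ℝ) * snrWeight L m α i₁ i₂ n := by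
  have hΓ := (Real.Gamma_pos_of_pos (erlangMinShape_pos hK0 n)).ne'
  have two_pow : (2 : ℝ) ^ (erlangMinShape n - 1) =
      2 ^ (∑ j : Fin K, (j : ℕ) * n j) * 2 ^ ((K : ℝ) - 1) := by
    rw [erlangMinShape, add_sub_right_comm, Real.rpow_add two_pos, Real.rpow_natCast, mul_comm]
  rw [erlangMinWeight, gammaRatioConst, two_pow, snrWeight, snrCoeff, snrConst_eq hK hα₂,
    snrExponent_eq hK hα₂, add_sub_cancel_right, prod_two_pow_div_factorial_pow]
  field_simp

theorem ofReal_snrKernel (hm : ∀ j, 0 < m j) (hL : 1 ≤ L) (hK0 : 0 < K) (hK : 2 * α 0 = (K : ℝ))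
    (hα₂ : α 1 = α 0 + 1 / 2) (hs : 0 < snrScale m g msq) {x : ℝ} (hx : 0 < x) :
    ((x⁻¹ * snrKernel (m 0) (m 1) L K (snrScale m g msq * x) : ℝ) : ℂ) =
      outputPDFFormula L K m α g msq x := by
  rw [snrKernel_eq_sum (hm 0) (hm 1) hL hK0 (mul_pos hs hx), sum_erlangMinIndex L K
    fun i₁ i₂ n => erlangMinWeight L i₁ i₂ n * gammaRatioKernel (m 0) (m 1) (erlangMinShape n)
      (snrScale m g msq * x / ((i₂ : ℝ) + 1) ^ 2), outputPDFFormula]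
  simp only [Complex.ofReal_mul, Complex.ofReal_sum, Finset.mul_sum]
  refine Finset.sum_congr rfl fun i₁ _ => Finset.sum_congr rfl fun i₂ _ =>
    Finset.sum_congr rfl fun n _ => ?_
  have weight_eq := congrArg Complex.ofReal
    (erlangMinWeight_mul_gammaRatioConst hK0 hK hα₂ L m i₁ i₂ n)
  push_cast at weight_eq
  rw [ofReal_gammaRatioKernel (hm 0) (hm 1) (erlangMinShape_pos hK0 n) (by positivity),
    ← mul_assoc (erlangMinWeight L i₁ i₂ n : ℂ), weight_eq, snrExponent_eq hK hα₂,
    Complex.ofReal_inv]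
  ring_nf

theorem ofReal_cumulative_snrKernel (hm : ∀ j, 0 < m j) (hL : 1 ≤ L) (hK0 : 0 < K)
    (hK : 2 * α 0 = (K : ℝ)) (hα₂ : α 1 = α 0 + 1 / 2) (hs : 0 < snrScale m g msq) {x : ℝ}
    (hx : 0 < x) :
    (cumulative (snrKernel (m 0) (m 1) L K) (snrScale m g msq * x) : ℂ) =
      outputCDFFormula L K m α g msq x := by
  rw [cumulative_snrKernel_eq_sum (hm 0) (hm 1) hL hK0 (mul_pos hs hx), sum_erlangMinIndex L K
    fun i₁ i₂ n => erlangMinWeight L i₁ i₂ n *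
      cumulative (gammaRatioKernel (m 0) (m 1) (erlangMinShape n))
        (snrScale m g msq * x / ((i₂ : ℝ) + 1) ^ 2), outputCDFFormula]
  simp only [Complex.ofReal_mul, Complex.ofReal_sum, Finset.mul_sum]
  refine Finset.sum_congr rfl fun i₁ _ => Finset.sum_congr rfl fun i₂ _ =>
    Finset.sum_congr rfl fun n _ => ?_
  have weight_eq := congrArg Complex.ofReal
    (erlangMinWeight_mul_gammaRatioConst hK0 hK hα₂ L m i₁ i₂ n)
  push_cast at weight_eq
  rw [ofReal_cumulative_gammaRatioKernel (hm 0) (hm 1) (erlangMinShape_pos hK0 n) (by positivity),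
    ← mul_assoc (erlangMinWeight L i₁ i₂ n : ℂ), weight_eq, snrExponent_eq hK hα₂]
  ring_nf

end ClosedForm

section Channel

variable {Ω : Type*} {L : ℕ} {m α g : Fin 2 → ℝ} {msq : ℝ} {N I : Fin L → Fin 2 → Ω → ℝ}

/-- The product of the squares `N_{i,j}²`, each rescaled to a gamma variable of rate `1`. -/
def normalizedMultipath (m : Fin 2 → ℝ) (msq : ℝ) (N : Fin L → Fin 2 → Ω → ℝ) (i : Fin L)
    (ω : Ω) : ℝ :=
  m 0 / msq * N i 0 ω ^ 2 * (m 1 / msq * N i 1 ω ^ 2)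

/-- `2 √(γ̄₁ γ̄₂ / (I_{i,1} I_{i,2}))`: a decreasing function of the shadowing variable of UAV `i`,
normalized so that it is Erlang distributed when `α₂ = α₁ + 1/2`. -/
def shadowingRoot (g : Fin 2 → ℝ) (I : Fin L → Fin 2 → Ω → ℝ) (i : Fin L) (ω : Ω) : ℝ :=
  2 * √(g 0 / I i 0 ω * (g 1 / I i 1 ω))

theorem shadowingRoot_eq (g : Fin 2 → ℝ) (I : Fin L → Fin 2 → Ω → ℝ) (i : Fin L) (ω : Ω) :
    shadowingRoot g I i ω = 2 * √(g 0 * g 1 / shadowingGain I i ω) := by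
  rw [shadowingRoot, shadowingGain, div_mul_div_comm]

theorem shadowingRoot_le_of_shadowingGain_le (hg : 0 ≤ g 0 * g 1) {i j : Fin L} {ω : Ω}
    (hi : 0 < shadowingGain I i ω) (hij : shadowingGain I i ω ≤ shadowingGain I j ω) :
    shadowingRoot g I j ω ≤ shadowingRoot g I i ω := by
  rw [shadowingRoot_eq, shadowingRoot_eq]
  gcongr

theorem snrScale_inv_mul_div_sq_shadowingRoot (hm : ∀ j, 0 < m j) (hg : ∀ j, 0 < g j)
    (hmsq : 0 < msq) {i : Fin L} {ω : Ω} (hi : 0 < shadowingGain I i ω) :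
    (snrScale m g msq)⁻¹ * (normalizedMultipath m msq N i ω / (shadowingRoot g I i ω ^ 2 / 4)) =
      multipathGain N i ω * shadowingGain I i ω := by
  have hm0 := hm 0
  have hm1 := hm 1
  have hg0 := hg 0
  have hg1 := hg 1
  rw [shadowingRoot_eq, mul_pow, Real.sq_sqrt (by positivity), snrScale, normalizedMultipath,
    multipathGain]
  field_simp
  norm_num

variable [MeasurableSpace Ω] {μ : Measure Ω} {sel : Ω → Fin L}

theorem IsShadowingSelection.outputSNR_eq (hsel : IsShadowingSelection I sel) (ω : Ω) :
    outputSNR N I sel ω = multipathGain N (sel ω) ω * shadowingGain I (sel ω) ω :=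
  have : Nonempty (Fin L) := ⟨sel ω⟩
  congrArg _ (le_antisymm (ciSup_le (hsel.2 ω))
    (le_ciSup (f := fun i => shadowingGain I i ω) (Set.finite_range _).bddAbove (sel ω)))

namespace IsDoubleShadowingChannel

theorem measurable_normalizedMultipath (hch : IsDoubleShadowingChannel μ m α g msq N I)
    (i : Fin L) : Measurable (normalizedMultipath m msq N i) :=
  (((hch.measurable_multipath i 0).pow_const 2).const_mul _).mul
    (((hch.measurable_multipath i 1).pow_const 2).const_mul _)

theorem measurable_shadowingRoot (hch : IsDoubleShadowingChannel μ m α g msq N I)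
    (i : Fin L) : Measurable (shadowingRoot g I i) :=
  (((hch.measurable_shadowing i 0).const_div _).mul
    ((hch.measurable_shadowing i 1).const_div _)).sqrt.const_mul _

theorem ae_shadowingGain_pos (hch : IsDoubleShadowingChannel μ m α g msq N I)
    (hg : ∀ j, 0 < g j) : ∀ᵐ ω ∂μ, ∀ i, 0 < shadowingGain I i ω := by
  have shadowing_pos : ∀ i j, ∀ᵐ ω ∂μ, 0 < I i j ω := fun i j => by
    refine ae_of_ae_map (hch.law_shadowing i j).aemeasurable ?_
    rw [(hch.law_shadowing i j).map_eq, invGammaMeasure_eq_mulDensity _ (hg j)]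
    exact ae_pos_mulDensity _
  exact ae_all_iff.2 fun i =>
    ((shadowing_pos i 0).and (shadowing_pos i 1)).mono fun ω h => mul_pos h.1 h.2

theorem measurable_row (hch : IsDoubleShadowingChannel μ m α g msq N I) (i : Fin L)
    (j : Fin 2 ⊕ Fin 2) : Measurable (Sum.elim (N i) (I i) j) := by
  cases j
  exacts [hch.measurable_multipath i _, hch.measurable_shadowing i _]

theorem iIndepFun_rows (hch : IsDoubleShadowingChannel μ m α g msq N I) :
    iIndepFun (fun i ω j => Sum.elim (N i) (I i) j ω) μ := by
  refine iIndepFun_curry hch.measurable_row ?_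
  let e : (_ : Fin L) × (Fin 2 ⊕ Fin 2) → (Fin L × Fin 2) ⊕ (Fin L × Fin 2) :=
    fun p => p.2.map (Prod.mk p.1) (Prod.mk p.1)
  have e_injective : e.Injective := by
    rintro ⟨i, j | j⟩ ⟨i', j' | j'⟩ h <;> simp_all [e]
  convert hch.indep.precomp e_injective using 2 with p
  rcases p with ⟨i, j | j⟩ <;> rfl

theorem iIndepFun_row (hch : IsDoubleShadowingChannel μ m α g msq N I) (i : Fin L) :
    iIndepFun (Sum.elim (N i) (I i)) μ := by
  have inj : (Sum.map (Prod.mk i) (Prod.mk i) :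
      Fin 2 ⊕ Fin 2 → (Fin L × Fin 2) ⊕ (Fin L × Fin 2)).Injective :=
    (Prod.mk_right_injective i).sumMap (Prod.mk_right_injective i)
  convert hch.indep.precomp inj using 2 with j
  cases j <;> rfl

theorem iIndepFun_normalizedMultipath_shadowingRoot
    (hch : IsDoubleShadowingChannel μ m α g msq N I) :
    iIndepFun (fun i ω => (normalizedMultipath m msq N i ω, shadowingRoot g I i ω)) μ :=
  hch.iIndepFun_rows.comp (fun _ (v : Fin 2 ⊕ Fin 2 → ℝ) =>
    (m 0 / msq * v (.inl 0) ^ 2 * (m 1 / msq * v (.inl 1) ^ 2),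
      2 * √(g 0 / v (.inr 0) * (g 1 / v (.inr 1))))) fun _ => by fun_prop

theorem indepFun_normalizedMultipath_shadowingRoot
    (hch : IsDoubleShadowingChannel μ m α g msq N I) (i : Fin L) :
    IndepFun (normalizedMultipath m msq N i) (shadowingRoot g I i) μ :=
  ((hch.iIndepFun_row i).indepFun_prodMk_prodMk (hch.measurable_row i)
    (.inl 0) (.inl 1) (.inr 0) (.inr 1) (by simp) (by simp) (by simp) (by simp)).comp
    (φ := fun v : ℝ × ℝ => m 0 / msq * v.1 ^ 2 * (m 1 / msq * v.2 ^ 2))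
    (ψ := fun v : ℝ × ℝ => 2 * √(g 0 / v.1 * (g 1 / v.2))) (by fun_prop) (by fun_prop)

theorem hasLaw_normalizedMultipath (hch : IsDoubleShadowingChannel μ m α g msq N I)
    (hm : ∀ j, 0 < m j) (hmsq : 0 < msq) (i : Fin L) :
    HasLaw (normalizedMultipath m msq N i) (gammaMeasure (m 0) 1 ∗ₘ gammaMeasure (m 1) 1) μ := by
  have := fun j => isProbabilityMeasure_gammaMeasure (hm j) one_pos
  have rescaled (j) : HasLaw (fun ω => m j / msq * N i j ω ^ 2) (gammaMeasure (m j) 1) μ :=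
    HasLaw.fun_comp ⟨by fun_prop, map_mul_left_gammaMeasure _ (div_pos (hm j) hmsq)⟩
      (hch.law_multipath i j)
  have indep : IndepFun (N i 0) (N i 1) μ :=
    (hch.iIndepFun_row i).indepFun (i := .inl 0) (j := .inl 1) (by simp)
  exact (indep.comp (φ := fun x => m 0 / msq * x ^ 2) (ψ := fun x => m 1 / msq * x ^ 2)
    (by fun_prop) (by fun_prop)).hasLaw_fun_mul (rescaled 0) (rescaled 1)

theorem hasLaw_shadowingRoot (hch : IsDoubleShadowingChannel μ m α g msq N I) (hα : 0 < α 0)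
    (hα₂ : α 1 = α 0 + 1 / 2) (hg : ∀ j, 0 < g j) (i : Fin L) :
    HasLaw (shadowingRoot g I i) (gammaMeasure (2 * α 0) 1) μ := by
  have hα_pos : ∀ j, 0 < α j := Fin.forall_fin_two.2 ⟨hα, by linarith⟩
  have := fun j => isProbabilityMeasure_gammaMeasure (hα_pos j) one_pos
  have reciprocal (j) : HasLaw (fun ω => g j / I i j ω) (gammaMeasure (α j) 1) μ :=
    HasLaw.fun_comp ⟨by fun_prop, map_const_div_invGammaMeasure _ (hg j)⟩
      (hch.law_shadowing i j)
  have indep : IndepFun (I i 0) (I i 1) μ :=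
    (hch.iIndepFun_row i).indepFun (i := .inr 0) (j := .inr 1) (by simp)
  have product := (indep.comp (φ := fun y => g 0 / y) (ψ := fun y => g 1 / y)
    (by fun_prop) (by fun_prop)).hasLaw_fun_mul (reciprocal 0) (reciprocal 1)
  exact HasLaw.fun_comp (Y := fun x => 2 * √x)
    ⟨by fun_prop, by rw [hα₂]; exact map_two_mul_sqrt_mconv_gammaMeasure hα⟩ product

theorem hasLaw_selected (hch : IsDoubleShadowingChannel μ m α g msq N I) (hm : ∀ j, 0 < m j)
    (hα : 0 < α 0) (hα₂ : α 1 = α 0 + 1 / 2) (hg : ∀ j, 0 < g j) (hmsq : 0 < msq)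
    (hsel : IsShadowingSelection I sel) :
    HasLaw (fun ω => (normalizedMultipath m msq N (sel ω) ω, shadowingRoot g I (sel ω) ω))
      ((gammaMeasure (m 0) 1 ∗ₘ gammaMeasure (m 1) 1).prod
        (minLaw L (gammaMeasure (2 * α 0) 1))) μ := by
  have := hch.indep.isProbabilityMeasure
  have := fun j => isProbabilityMeasure_gammaMeasure (hm j) one_pos
  have := isProbabilityMeasure_gammaMeasure (mul_pos two_pos hα) one_pos
  have smallest : ∀ᵐ ω ∂μ, ∀ j, shadowingRoot g I (sel ω) ω ≤ shadowingRoot g I j ω :=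
    (hch.ae_shadowingGain_pos hg).mono fun ω hω j =>
      shadowingRoot_le_of_shadowingGain_le (mul_pos (hg 0) (hg 1)).le (hω j) (hsel.2 ω j)
  have pair_law := fun i => (hch.indepFun_normalizedMultipath_shadowingRoot i).hasLaw_prod
    (hch.hasLaw_normalizedMultipath hm hmsq i) (hch.hasLaw_shadowingRoot hα hα₂ hg i)
  simpa only [Fintype.card_fin] using
    _root_.hasLaw_selected hch.iIndepFun_normalizedMultipath_shadowingRoot
      hch.measurable_normalizedMultipath hch.measurable_shadowingRoot pair_law hsel.1 smallest

theorem hasLaw_outputSNR {K : ℕ} (hch : IsDoubleShadowingChannel μ m α g msq N I)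
    (hm : ∀ j, 0 < m j) (hK0 : 0 < K) (hK : 2 * α 0 = (K : ℝ)) (hα₂ : α 1 = α 0 + 1 / 2)
    (hg : ∀ j, 0 < g j) (hmsq : 0 < msq) (hsel : IsShadowingSelection I sel) :
    HasLaw (outputSNR N I sel)
      (mulDensity fun x => snrKernel (m 0) (m 1) L K (snrScale m g msq * x)) μ := by
  have hα : 0 < α 0 := by
    have : (0 : ℝ) < K := Nat.cast_pos.2 hK0
    linarith
  have quotient_law : HasLaw (fun ω => normalizedMultipath m msq N (sel ω) ω /
      (shadowingRoot g I (sel ω) ω ^ 2 / 4)) (mulDensity (snrKernel (m 0) (m 1) L K)) μ :=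
    HasLaw.fun_comp (Y := fun q : ℝ × ℝ => q.1 / (q.2 ^ 2 / 4))
      ⟨by fun_prop, by rw [hK, map_div_sq_mconv_prod_minLaw (hm 0) (hm 1) L hK0]⟩
      (hch.hasLaw_selected hm hα hα₂ hg hmsq hsel)
  have scale_pos := snrScale_pos hm hg hmsq
  have unscaled : mulDensity (snrKernel (m 0) (m 1) L K) = mulDensity fun x =>
      snrKernel (m 0) (m 1) L K (snrScale m g msq * ((snrScale m g msq)⁻¹ * x)) := by
    simp only [mul_inv_cancel_left₀ scale_pos.ne']
  refine (HasLaw.fun_comp ⟨by fun_prop, ?_⟩ quotient_law).congr <|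
    (hch.ae_shadowingGain_pos hg).mono fun ω hω => (hsel.outputSNR_eq ω).trans
      (snrScale_inv_mul_div_sq_shadowingRoot hm hg hmsq (hω _)).symm
  rw [unscaled]
  exact map_mul_left_mulDensity
    (fun x => snrKernel (m 0) (m 1) L K (snrScale m g msq * x)) (inv_pos.2 scale_pos)

end IsDoubleShadowingChannel

end Channel

theorem cumulative_comp_mul_left (k : ℝ → ℝ) (r z : ℝ) :
    cumulative (fun x => k (r * x)) z = cumulative k (r * z) := by
  simp only [cumulative, dilationAverage, mul_assoc]

theorem mainTheorem7_general {Ω : Type*} [MeasurableSpace Ω] (μ : Measure Ω)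
    [IsProbabilityMeasure μ] (L K : ℕ) (m α g : Fin 2 → ℝ) (msq : ℝ) (hm : ∀ j, 0 < m j)
    (hα : 0 < α 0) (hg : ∀ j, 0 < g j) (hmsq : 0 < msq)
    (hK : 2 * α 0 = (K : ℝ)) (hα₂ : α 1 = α 0 + 1 / 2)
    (N I : Fin L → Fin 2 → Ω → ℝ) (hch : IsDoubleShadowingChannel μ m α g msq N I)
    (sel : Ω → Fin L) (hsel : IsShadowingSelection I sel) :
    (∃ f : ℝ → ℝ,
        Measurable f ∧ (∀ x, 0 ≤ f x) ∧ (∀ x ≤ 0, f x = 0) ∧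
        (∀ x, 0 < x → (f x : ℂ) = outputPDFFormula L K m α g msq x) ∧
        HasLaw (outputSNR N I sel) (volume.withDensity fun x => ENNReal.ofReal (f x)) μ) ∧
    (∀ x, x ≤ 0 → cdf (μ.map (outputSNR N I sel)) x = 0) ∧
    (∀ x, 0 < x →
        ((cdf (μ.map (outputSNR N I sel)) x : ℝ) : ℂ) = outputCDFFormula L K m α g msq x) := by
  obtain ⟨ω⟩ := μ.nonempty_of_neZero
  have hL : 1 ≤ L := Fin.pos (sel ω)
  have hK0 : 0 < K := Nat.cast_pos.1 (hK ▸ mul_pos two_pos hα)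
  have hs := snrScale_pos hm hg hmsq
  set k : ℝ → ℝ := fun x => snrKernel (m 0) (m 1) L K (snrScale m g msq * x) with hk
  have k_measurable : Measurable k := by fun_prop
  have k_nonneg : ∀ x, 0 < x → 0 ≤ k x := fun x hx =>
    snrKernel_nonneg (m 1) L K (hm 0) (mul_pos hs hx)
  have law : HasLaw (outputSNR N I sel) (mulDensity k) μ :=
    hch.hasLaw_outputSNR hm hK0 hK hα₂ hg hmsq hsel
  have : IsProbabilityMeasure (mulDensity k) := law.isProbabilityMeasure_iff.1 inferInstance
  rw [law.map_eq]
  refine ⟨⟨(Set.Ioi 0).indicator fun x => x⁻¹ * k x,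
    (measurable_inv.mul k_measurable).indicator measurableSet_Ioi,
    Set.indicator_nonneg fun x hx => mul_nonneg (inv_nonneg.2 hx.le) (k_nonneg x hx),
    fun x hx => Set.indicator_of_notMem hx.not_gt _, fun x hx => ?_,
    mulDensity_eq_withDensity_indicator k ▸ law⟩,
    fun x hx => cdf_mulDensity_of_nonpos k hx, fun x hx => ?_⟩
  · rw [Set.indicator_of_mem (Set.mem_Ioi.2 hx)]
    exact ofReal_snrKernel hm hL hK0 hK hα₂ hs hx
  · rw [cdf_mulDensity k_measurable k_nonneg hx, hk, cumulative_comp_mul_left]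
    · exact ofReal_cumulative_snrKernel hm hL hK0 hK hα₂ hs hx
    · simp only [hk, ← mul_assoc]
      exact integrable_snrKernel_comp (hm 0) (hm 1) hL hK0 (mul_pos hs hx)

end

theorem mainTheorem7 {Ω : Type*} [MeasurableSpace Ω] (μ : Measure Ω) [IsProbabilityMeasure μ]
    (L K : ℕ) (hL : 1 ≤ L)
    (m α g : Fin 2 → ℝ) (msq : ℝ)
    (hm : ∀ j, 0 < m j) (hα : ∀ j, 1 < α j) (hg : ∀ j, 0 < g j) (hmsq : 0 < msq)
    (hK : 2 * α 0 = (K : ℝ)) (hα₂ : α 1 = α 0 + 1 / 2)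
    (N I : Fin L → Fin 2 → Ω → ℝ) (hch : IsDoubleShadowingChannel μ m α g msq N I)
    (sel : Ω → Fin L) (hsel : IsShadowingSelection I sel) :
    (∃ f : ℝ → ℝ,
        Measurable f ∧ (∀ x, 0 ≤ f x) ∧ (∀ x ≤ 0, f x = 0) ∧
        (∀ x, 0 < x → (f x : ℂ) = outputPDFFormula L K m α g msq x) ∧
        HasLaw (outputSNR N I sel) (volume.withDensity fun x => ENNReal.ofReal (f x)) μ) ∧
    (∀ x, x ≤ 0 → cdf (μ.map (outputSNR N I sel)) x = 0) ∧
    (∀ x, 0 < x →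
        ((cdf (μ.map (outputSNR N I sel)) x : ℝ) : ℂ) = outputCDFFormula L K m α g msq x) :=
  mainTheorem7_general μ L K m α g msq hm (one_pos.trans (hα 0)) hg hmsq hK hα₂ N I hch sel hsel
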